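/- **Setting.** Let $(X,d)$ be a metric space with a Borel measure $\mu$ such that $0<\mu(B(x,r))<\infty$ for all $x\in X$, $r\in(0,\infty)$. A variable exponent is a measurable $q:X\to(0,\infty]$ with $q^-:=\operatorname{ess\,inf}q>0$; $q\in\mathcal P(X)$. $\mathcal P_b^{\log}(X)$ is the set of exponents $p$ with $p^+:=\operatorname{ess\,sup}p<\infty$ for which $1/p$ is log-Hölder: $|1/p(x)-1/p(y)|\le C/\log(e+1/d(x,y))$ for all $x\ne y$, for some $C>0$ (such $p$ are finite everywhere). Write $\gamma\gg p$ if $\operatorname{ess\,inf}(\gamma-p)>0$. For $E\subseteq X$ measurable, $\|f\|_{L^{p(\cdot)}(E)}:=\inf\{t\in(0,\infty):\int_E|f/t|^{p(x)}\,d\mu\le1\}$ (with $\inf\emptyset=\infty$). For $s\in\mathcal P_b^{\log}(X)$ a sequence $g=(g_k)_{k\in\mathbb Z}$ of measurable functions $g_k\ge 0$ is a vector $s(\cdot)$-gradient of a measurable function $u$ on $E$ if, off a null set, $|u(x)-u(y)|\le d(x,y)^{s(x)}g_k(x)+d(x,y)^{s(y)}g_k(y)$ for all $k\in\mathbb Z$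 and all $x,y\in E$ with $2^{-k-1}\le d(x,y)<2^{-k}$. Let $\|u\|_{\dot M^{s(\cdot)}_{p(\cdot),q(\cdot)}(E)}$ and $\|u\|_{\dot N^{s(\cdot)}_{p(\cdot),q(\cdot)}(E)}$ be the infimum over all such $g$ of, respectively, $\big\|\,\|(g_k)_k\|_{\ell^{q(\cdot)}}\big\|_{L^{p(\cdot)}(E)}$ and $$\|g\|_{\ell^{q(\cdot)}(L^{p(\cdot)}(E))}:=\inf\Big\{\lambda\in(0,\infty):\sum_{k\in\mathbb Z}\inf\big\{t\in(0,\infty):\int_E\big(\tfrac{g_k}{\lambda t^{1/q(x)}}\big)^{p(x)}d\mu\le1\big\}\le1\Big\},\qquad t^{1/\infty}:=1 .$$ For $A\in\{M,N\}$, $\dot A^{s(\cdot)}_{p(\cdot),q(\cdot)}(E)$ consists of the measurable $u$ (identified a.e.) with finite $\dot A$-quasi-norm, and $\|u\|_{A^{s(\cdot)}_{p(\cdot),q(\cdot)}(X)}:=\|u\|_{L^{p(\cdot)}(X)}+\|u\|_{\dot A^{s(\cdot)}_{p(\cdot),q(\cdot)}(X)}$ is the inhomogeneous quasi-norm. The measure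 $\mu$ is *lower Ahlfors $Q(\cdot)$-regular* if there is $b>0$ with $\mu(B(x,r))\ge b\,r^{Q(x)}$ for all $x\in X$, $r\in(0,1]$. The space $X$ is *uniformly perfect* if there is $\lambda\in(0,1)$ such that $B(x,r)\setminus B(x,\lambda r)\ne\emptyset$ whenever $x\in X$, $r>0$ and $X\setminus B(x,r)\neq\emptyset$. **Theorem.** Let $A\in\{M,N\}$, $\sigma\in[1,\infty)$, $p,s\in\mathcal P_b^{\log}(X)$ and $q\in\mathcal P(X)$, and assume that $s^+\le1$, with $s^+=1$ allowed only if $q^-=\infty$. (i) Let $\gamma\in\mathcal P_b^{\log}(X)$, $\gamma\gg p$, and suppose that there is a constant $C>0$ such that one of the following holds: (a) $\|u\|_{L^{\gamma(\cdot)}(X)}\le C\|u\|_{\dot A^{s(\cdot)}_{p(\cdot),q(\cdot)}(X)}$ for all $u\in\dot A^{s(\cdot)}_{p(\cdot),q(\cdot)}(X)$; (b) $\inf_{c\in\mathbb R}\|u-c\|_{L^{\gamma(\cdot)}(X)}\le C\|u\|_{\dot A^{s(\cdot)}_{p(\cdot),q(\cdot)}(X)}$ for all $u\in\dot A^{s(\cdot)}_{p(\cdot),q(\cdot)}(X)$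 (the embedding modulo constants); (c) $\|u\|_{L^{\gamma(\cdot)}(X)}\le C\|u\|_{A^{s(\cdot)}_{p(\cdot),q(\cdot)}(X)}$ for all $u\in A^{s(\cdot)}_{p(\cdot),q(\cdot)}(X)$ (the inhomogeneous embedding). Then $\mu$ is lower Ahlfors $Q(\cdot)$-regular with $Q=\frac{\gamma sp}{\gamma-p}$. Assume in addition that $X$ is uniformly perfect. Then: (ii) Let $\gamma\in\mathcal P_b^{\log}(X)$, $\gamma\gg p$, $Q:=\frac{sp\gamma}{\gamma-p}$, and suppose there are $C_S,\omega>0$ such that for all $x_0\in X$, $0<r_0\le1/\sigma$, with $B_0=B(x_0,r_0)$, $\sigma B_0=B(x_0,\sigma r_0)$, and all $u\in\dot A^{s(\cdot)}_{p(\cdot),q(\cdot)}(\sigma B_0)$, $$\inf_{c\in\mathbb R}\|u-c\|_{L^{\gamma(\cdot)}(B_0)}\le C_S\Big(\frac{\mu(B_0)}{r_0^{Q(x_0)}}\Big)^{\omega}\|u\|_{\dot A^{s(\cdot)}_{p(\cdot),q(\cdot)}(\sigma B_0)} .$$ Then $\mu$ is lower Ahlfors $Q(\cdot)$-regular. (iii)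 Suppose there are $C_1,C_2,\omega>0$ such that for all $x_0\in X$, $0<r_0\le1/\sigma$, with $B_0$ and $\sigma B_0$ as in (ii), and all $u\in\dot A^{s(\cdot)}_{p(\cdot),q(\cdot)}(\sigma B_0)$ with $\|u\|_{\dot A^{s(\cdot)}_{p(\cdot),q(\cdot)}(\sigma B_0)}>0$, $$\inf_{c\in\mathbb R}\frac1{\mu(B_0)}\int_{B_0}\exp\bigg[\Big(C_1\frac{|u(x)-c|}{\|u\|_{\dot A^{s(\cdot)}_{p(\cdot),q(\cdot)}(\sigma B_0)}}\Big)^{\omega}\bigg]d\mu(x)\le C_2 .$$ Then $\mu$ is lower Ahlfors $Q(\cdot)$-regular with $Q=sp$. (iv) Suppose that $X$ has at least two points, $\alpha\in\mathcal P_b^{\log}(X)$, and there is $C>0$ such that every $u\in\dot A^{s(\cdot)}_{p(\cdot),q(\cdot)}(X)$ has a continuous representative $v$ with $\sup_{x\ne y}\frac{|v(x)-v(y)|}{d(x,y)^{\alpha(x)}}\le C\|u\|_{\dot A^{s(\cdot)}_{p(\cdot),q(\cdot)}(X)}$ (that is, $\dot A^{s(\cdot)}_{p(\cdot),q(\cdot)}(X)\hookrightarrow\dot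 C^{0,\alpha(\cdot)}(X)$). Then $s\ge\alpha$ everywhere on $X$, $\mu$ is lower Ahlfors $Q(\cdot)$-regular with $Q=p(s-\alpha)$, and $\mu(\{x_0\})>0$ for every $x_0\in X$ with $s(x_0)=\alpha(x_0)$. -/

import Mathlib

open MeasureTheory Set
open scoped ENNReal

/-! ### Metric measure spaces -/

/-- The standing assumption on the Borel measure of a metric measure space:
every ball of positive finite radius has positive and finite measure. -/
def IsMetricMeasure {X : Type*} [MetricSpace X] [MeasurableSpace X] (μ : Measure X) : Prop :=
  ∀ (x : X) (r : ℝ), 0 < r → 0 < μ (Metric.ball x r) ∧ μ (Metric.ball x r) < ∞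

/-- Lower Ahlfors `Q(·)`-regularity: `μ (B(x,r)) ≥ b r ^ Q(x)` for all `x` and `r ∈ (0,1]`. -/
def LowerAhlforsRegular {X : Type*} [MetricSpace X] [MeasurableSpace X] (μ : Measure X)
    (Q : X → ℝ) : Prop :=
  ∃ b : ℝ, 0 < b ∧ ∀ (x : X) (r : ℝ), 0 < r → r ≤ 1 →
    ENNReal.ofReal (b * r ^ Q x) ≤ μ (Metric.ball x r)

/-- Uniform perfectness of a metric space. -/
def UniformlyPerfect (X : Type*) [MetricSpace X] : Prop :=
  ∃ l : ℝ, 0 < l ∧ l < 1 ∧ ∀ (x : X) (r : ℝ), 0 < r →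
    ((Metric.ball x r)ᶜ).Nonempty → (Metric.ball x r \ Metric.ball x (l * r)).Nonempty

/-! ### Variable exponents -/

/-- The class of all variable exponents `q : X → (0,∞]`: measurable with `q⁻ > 0`. -/
def IsExponent {X : Type*} [MeasurableSpace X] (μ : Measure X) (q : X → ℝ≥0∞) : Prop :=
  Measurable q ∧ (∀ x, 0 < q x) ∧ 0 < essInf q μ

/-- Essentially bounded (real-valued) variable exponents: `0 < p⁻` and `p⁺ < ∞`. -/
def IsBddExponent {X : Type*} [MeasurableSpace X] (μ : Measure X) (p : X → ℝ) : Prop :=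
  Measurable p ∧ (∀ x, 0 < p x) ∧
    (∃ m : ℝ, 0 < m ∧ ∀ᵐ x ∂μ, m ≤ p x) ∧ (∃ M : ℝ, ∀ᵐ x ∂μ, p x ≤ M)

/-- Local log-Hölder continuity of a function on the whole space. -/
def LogHolder {X : Type*} [MetricSpace X] (f : X → ℝ) : Prop :=
  ∃ C : ℝ, 0 < C ∧ ∀ x y : X, x ≠ y →
    |f x - f y| ≤ C / Real.log (Real.exp 1 + 1 / dist x y)

/-- Bounded variable exponents `p` for which `1/p` is locally log-Hölder continuous.
(Since `1/p` is then continuous and balls have positive measure, such a `p` is real-valued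
and bounded everywhere, so nothing is lost by taking values in `ℝ` from the start.) -/
def IsBddLogExponent {X : Type*} [MetricSpace X] [MeasurableSpace X] (μ : Measure X)
    (p : X → ℝ) : Prop :=
  IsBddExponent μ p ∧ LogHolder (fun x => 1 / p x)

/-- `p ≫ q`, that is, `(p - q)⁻ > 0`. -/
def ExponentGG {X : Type*} [MeasurableSpace X] (μ : Measure X) (p q : X → ℝ) : Prop :=
  ∃ ε : ℝ, 0 < ε ∧ ∀ᵐ x ∂μ, ε ≤ p x - q x

/-- `s⁺ ≼_{q⁻} 1`: `s⁺ ≤ 1`, and the value `s⁺ = 1` is permitted only if `q⁻ = ∞`. -/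
def SmoothnessAdmissible {X : Type*} [MeasurableSpace X] (μ : Measure X)
    (s : X → ℝ) (q : X → ℝ≥0∞) : Prop :=
  essSup (fun x => ENNReal.ofReal (s x)) μ ≤ 1 ∧
    (essSup (fun x => ENNReal.ofReal (s x)) μ = 1 → essInf q μ = ∞)

/-! ### Variable exponent Lebesgue and mixed Lebesgue sequence spaces

All quasi-norms are `[0,∞]`-valued; the corresponding space consists of the measurable
functions (or sequences) whose quasi-norm is finite. -/

/-- The semi-modular `∫ f(x) ^ p(x) dν(x)` of a nonnegative function. -/
noncomputable def lebesgueModular {X : Type*} [MeasurableSpace X] (ν : Measure X) (p : X → ℝ)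
    (f : X → ℝ≥0∞) : ℝ≥0∞ :=
  ∫⁻ x, f x ^ p x ∂ν

/-- The Luxemburg quasi-norm of `L^{p(·)}(ν)` of a nonnegative function. -/
noncomputable def lebesgueNorm {X : Type*} [MeasurableSpace X] (ν : Measure X) (p : X → ℝ)
    (f : X → ℝ≥0∞) : ℝ≥0∞ :=
  sInf {t : ℝ≥0∞ | 0 < t ∧ t < ∞ ∧ lebesgueModular ν p (fun x => f x / t) ≤ 1}

/-- The pointwise `ℓ^{q}`-quasi-norm of a nonnegative two-sided sequence, `0 < q ≤ ∞`. -/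
noncomputable def seqNorm (q : ℝ≥0∞) (a : ℤ → ℝ≥0∞) : ℝ≥0∞ :=
  if q = ∞ then ⨆ k, a k else (∑' k, a k ^ q.toReal) ^ (1 / q.toReal)

/-- The quasi-norm of `L^{p(·)}(ℓ^{q(·)})`. -/
noncomputable def lebesgueSeqNorm {X : Type*} [MeasurableSpace X] (ν : Measure X) (p : X → ℝ)
    (q : X → ℝ≥0∞) (g : ℤ → X → ℝ≥0∞) : ℝ≥0∞ :=
  lebesgueNorm ν p (fun x => seqNorm (q x) (fun k => g k x))

/-- The semi-modular of `ℓ^{q(·)}(L^{p(·)})`; for `q x = ∞` the exponent `(q x)⁻¹.toReal` is `0`,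
in accordance with the convention `t ^ (1/∞) = 1`. -/
noncomputable def seqLebesgueModular {X : Type*} [MeasurableSpace X] (ν : Measure X) (p : X → ℝ)
    (q : X → ℝ≥0∞) (g : ℤ → X → ℝ≥0∞) : ℝ≥0∞ :=
  ∑' k, sInf {t : ℝ≥0∞ | 0 < t ∧ t < ∞ ∧
    lebesgueModular ν p (fun x => g k x / t ^ ((q x)⁻¹).toReal) ≤ 1}

/-- The quasi-norm of `ℓ^{q(·)}(L^{p(·)})`. -/
noncomputable def seqLebesgueNorm {X : Type*} [MeasurableSpace X] (ν : Measure X) (p : X → ℝ)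
    (q : X → ℝ≥0∞) (g : ℤ → X → ℝ≥0∞) : ℝ≥0∞ :=
  sInf {t : ℝ≥0∞ | 0 < t ∧ t < ∞ ∧ seqLebesgueModular ν p q (fun k x => g k x / t) ≤ 1}

/-! ### Hajłasz–Triebel–Lizorkin and Hajłasz–Besov spaces

Functions are identified when they agree almost everywhere, so that it is enough to consider
real-valued representatives. For a measurable set `E`, functions on the metric measure space
`(E, d, μ)` are represented by functions on `X`, of which only the values on `E` are used. -/

/-- `g = (g_k)` is a vector `s(·)`-gradient of `u` on the measurable set `E`. -/
def IsVectorGradient {X : Type*} [MetricSpace X] [MeasurableSpace X] (μ : Measure X)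
    (s : X → ℝ) (E : Set X) (u : X → ℝ) (g : ℤ → X → ℝ≥0∞) : Prop :=
  (∀ k, Measurable (g k)) ∧
    ∃ N : Set X, μ N = 0 ∧ ∀ k : ℤ, ∀ x ∈ E \ N, ∀ y ∈ E \ N,
      (2 : ℝ) ^ (-k - 1) ≤ dist x y → dist x y < (2 : ℝ) ^ (-k) →
        ENNReal.ofReal |u x - u y| ≤
          ENNReal.ofReal (dist x y ^ s x) * g k x + ENNReal.ofReal (dist x y ^ s y) * g k y

/-- The two scales of spaces: `M` (Hajłasz–Triebel–Lizorkin) and `N` (Hajłasz–Besov). -/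
inductive HajlaszScale where
  | M
  | N

/-- The sequence quasi-norm underlying each of the two scales:
`L^{p(·)}(ℓ^{q(·)})` for `M` and `ℓ^{q(·)}(L^{p(·)})` for `N`. -/
noncomputable def gradientNorm {X : Type*} [MeasurableSpace X] (A : HajlaszScale)
    (ν : Measure X) (p : X → ℝ) (q : X → ℝ≥0∞) (g : ℤ → X → ℝ≥0∞) : ℝ≥0∞ :=
  match A with
  | .M => lebesgueSeqNorm ν p q g
  | .N => seqLebesgueNorm ν p q g

/-- The homogeneous quasi-(semi)norm of `u` in `Ȧ^{s(·)}_{p(·),q(·)}(E, d, μ)`. -/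
noncomputable def homNorm {X : Type*} [MetricSpace X] [MeasurableSpace X] (A : HajlaszScale)
    (μ : Measure X) (s p : X → ℝ) (q : X → ℝ≥0∞) (E : Set X) (u : X → ℝ) : ℝ≥0∞ :=
  ⨅ (g : ℤ → X → ℝ≥0∞) (_ : IsVectorGradient μ s E u g), gradientNorm A (μ.restrict E) p q g

/-- Membership in the homogeneous space `Ȧ^{s(·)}_{p(·),q(·)}(E, d, μ)`. -/
def MemHom {X : Type*} [MetricSpace X] [MeasurableSpace X] (A : HajlaszScale)
    (μ : Measure X) (s p : X → ℝ) (q : X → ℝ≥0∞) (E : Set X) (u : X → ℝ) : Prop :=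
  Measurable u ∧ homNorm A μ s p q E u < ∞

/-- The quasi-norm of `u` in the inhomogeneous space `A^{s(·)}_{p(·),q(·)}(X, d, μ)`. -/
noncomputable def inhomNorm {X : Type*} [MetricSpace X] [MeasurableSpace X] (A : HajlaszScale)
    (μ : Measure X) (s p : X → ℝ) (q : X → ℝ≥0∞) (u : X → ℝ) : ℝ≥0∞ :=
  lebesgueNorm μ p (fun x => ENNReal.ofReal |u x|) + homNorm A μ s p q univ u

/-! ### Exponential averages -/

/-- The integral average over `B` of `exp (f(x) ^ ω)`. -/
noncomputable def expAverage {X : Type*} [MeasurableSpace X] (μ : Measure X) (B : Set X)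
    (ω : ℝ) (f : X → ℝ) : ℝ≥0∞ :=
  (∫⁻ x in B, ENNReal.ofReal (Real.exp (f x ^ ω)) ∂μ) / μ B

/-! ### Global embeddings -/

/-- `Ȧ^{s(·)}_{p(·),q(·)}(X) ↪ L^{γ(·)}(X)`, read literally. -/
def HomEmbedsLebesgue {X : Type*} [MetricSpace X] [MeasurableSpace X] (A : HajlaszScale)
    (μ : Measure X) (s p : X → ℝ) (q : X → ℝ≥0∞) (γ : X → ℝ) : Prop :=
  ∃ C : ℝ, 0 < C ∧ ∀ u : X → ℝ, MemHom A μ s p q univ u →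
    lebesgueNorm μ γ (fun x => ENNReal.ofReal |u x|) ≤
      ENNReal.ofReal C * homNorm A μ s p q univ u

/-- `Ȧ^{s(·)}_{p(·),q(·)}(X) ↪ L^{γ(·)}(X)` modulo additive constants. -/
def HomEmbedsLebesgueModConst {X : Type*} [MetricSpace X] [MeasurableSpace X] (A : HajlaszScale)
    (μ : Measure X) (s p : X → ℝ) (q : X → ℝ≥0∞) (γ : X → ℝ) : Prop :=
  ∃ C : ℝ, 0 < C ∧ ∀ u : X → ℝ, MemHom A μ s p q univ u →
    (⨅ c : ℝ, lebesgueNorm μ γ (fun x => ENNReal.ofReal |u x - c|)) ≤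
      ENNReal.ofReal C * homNorm A μ s p q univ u

/-- `A^{s(·)}_{p(·),q(·)}(X) ↪ L^{γ(·)}(X)` for the inhomogeneous space. -/
def InhomEmbedsLebesgue {X : Type*} [MetricSpace X] [MeasurableSpace X] (A : HajlaszScale)
    (μ : Measure X) (s p : X → ℝ) (q : X → ℝ≥0∞) (γ : X → ℝ) : Prop :=
  ∃ C : ℝ, 0 < C ∧ ∀ u : X → ℝ, Measurable u → inhomNorm A μ s p q u < ∞ →
    lebesgueNorm μ γ (fun x => ENNReal.ofReal |u x|) ≤
      ENNReal.ofReal C * inhomNorm A μ s p q u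

/-- The variable exponent Hölder seminorm `sup_{x ≠ y} |v(x) - v(y)| / d(x,y) ^ α(x)`. -/
noncomputable def holderSeminorm {X : Type*} [MetricSpace X] (α : X → ℝ) (v : X → ℝ) : ℝ≥0∞ :=
  ⨆ (x : X) (y : X) (_ : x ≠ y), ENNReal.ofReal (|v x - v y| / dist x y ^ α x)

/-- `Ȧ^{s(·)}_{p(·),q(·)}(X) ↪ Ċ^{0,α(·)}(X)`: every `u` in the former space has a continuous
representative in the latter one, with control of the seminorm. -/
def HomEmbedsHolder {X : Type*} [MetricSpace X] [MeasurableSpace X] (A : HajlaszScale)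
    (μ : Measure X) (s p : X → ℝ) (q : X → ℝ≥0∞) (α : X → ℝ) : Prop :=
  ∃ C : ℝ, 0 < C ∧ ∀ u : X → ℝ, MemHom A μ s p q univ u →
    ∃ v : X → ℝ, Continuous v ∧ v =ᵐ[μ] u ∧
      holderSeminorm α v ≤ ENNReal.ofReal C * homNorm A μ s p q univ u

/-!
All the embeddings are tested on the radial bumps that are `1` on `B(z,t')` and vanish off `B(z,t)`.
Such a bump has a vector `s(·)`-gradient of norm about `(t - t') ^ (-s) * μ (B(z,t)) ^ (1/p)`, while
its distance to the constants in `L^{γ(·)}` is at least about `μ (B(z,t')) ^ (1/γ)`, as soon as the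
complement of `B(z,t)` carries enough mass. Choosing `t'` such that `μ (B(z,t'))` is about half of
`μ (B(z,t))`, the embedding bounds the gap `(t - t') ^ s` by `μ (B(z,t)) ^ (1/p - 1/γ)`, and the
gaps of the successive halving radii add up to the whole radius as a geometric series. This gives
`r ^ s ≤ C * μ (B(x,r)) ^ (1/p - 1/γ)`, that is, lower regularity with `Q = s / (1/p - 1/γ)`.
A Moser–Trudinger inequality corresponds to `1/γ → 0`, and a Hölder inequality needs a single bump.

The exponents are frozen at the centre `x`. On `B(x,r)` they vary by some `d` with
`d * log (1/r) ≤ C`, so freezing them costs factors `r ^ (-d)`, which are bounded, and powers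
`μ (B(x,r)) ^ (-d)`, which are absorbed because `μ (B(x,r))` itself is bounded below by the
inequality with the slightly worse exponents. In the local inequalities uniform perfectness
provides two disjoint balls of comparable radii inside `B(x,r)`: the bump sits on the one of smaller
measure, and the other takes the role of the complement.
-/

/-! ### Variable exponent quasi-norms -/

section Norms

variable {X : Type*} [MeasurableSpace X] {ν : Measure X} {p : X → ℝ} {q : X → ℝ≥0∞}
  {f g : X → ℝ≥0∞}

theorem lebesgueModular_mono_ae (hp : ∀ x, 0 ≤ p x) (h : f ≤ᵐ[ν] g) :
    lebesgueModular ν p f ≤ lebesgueModular ν p g :=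
  lintegral_mono_ae <| h.mono fun x hx => ENNReal.rpow_le_rpow hx (hp x)

theorem lebesgueNorm_le {t : ℝ≥0∞} (ht₀ : 0 < t) (ht : t < ∞)
    (h : lebesgueModular ν p (fun x => f x / t) ≤ 1) : lebesgueNorm ν p f ≤ t :=
  sInf_le ⟨ht₀, ht, h⟩

theorem lebesgueNorm_mono_ae (hp : ∀ x, 0 ≤ p x) (h : f ≤ᵐ[ν] g) :
    lebesgueNorm ν p f ≤ lebesgueNorm ν p g := by
  refine le_sInf fun t ht => lebesgueNorm_le ht.1 ht.2.1 (le_trans ?_ ht.2.2)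
  exact lebesgueModular_mono_ae hp <| h.mono fun x hx => ENNReal.div_le_div_right hx t

theorem lebesgueNorm_mono_measure {ν' : Measure X} (h : ν ≤ ν') :
    lebesgueNorm ν p f ≤ lebesgueNorm ν' p f :=
  le_sInf fun _ ht => lebesgueNorm_le ht.1 ht.2.1 ((lintegral_mono' h le_rfl).trans ht.2.2)

theorem lebesgueNorm_const_mul_le {c : ℝ≥0∞} (hc₀ : c ≠ 0) (hc : c ≠ ∞) :
    lebesgueNorm ν p (fun x => c * f x) ≤ c * lebesgueNorm ν p f := by
  rw [mul_comm, ← ENNReal.div_le_iff hc₀ hc]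
  refine le_sInf fun t ⟨ht₀, ht, hmod⟩ => ?_
  rw [ENNReal.div_le_iff hc₀ hc, mul_comm]
  refine lebesgueNorm_le (ENNReal.mul_pos hc₀ ht₀.ne') (ENNReal.mul_lt_top hc.lt_top ht) ?_
  simpa only [ENNReal.mul_div_mul_left _ _ hc₀ hc] using hmod

theorem lebesgueModular_le_rpow_of_lebesgueNorm_lt {p₀ : ℝ} (hp₀ : 0 < p₀) (hp : ∀ x, p₀ ≤ p x)
    {θ : ℝ≥0∞} (hθ : θ ≤ 1) (h : lebesgueNorm ν p f < θ) :
    lebesgueModular ν p f ≤ θ ^ p₀ := by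
  obtain ⟨t, ⟨ht₀, ht, hmod⟩, htθ⟩ := sInf_lt_iff.mp h
  calc lebesgueModular ν p f ≤ ∫⁻ x, θ ^ p₀ * (f x / t) ^ p x ∂ν := by
        refine lintegral_mono fun x => ?_
        have hpx : 0 ≤ p x := hp₀.le.trans (hp x)
        calc f x ^ p x = t ^ p x * (f x / t) ^ p x := by
              rw [← ENNReal.mul_rpow_of_nonneg _ _ hpx, ENNReal.mul_div_cancel ht₀.ne' ht.ne]
          _ ≤ θ ^ p₀ * (f x / t) ^ p x := by
              gcongr
              exact (ENNReal.rpow_le_rpow htθ.le hpx).trans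
                (ENNReal.rpow_le_rpow_of_exponent_ge hθ (hp x))
    _ = θ ^ p₀ * lebesgueModular ν p fun x => f x / t := by
        refine lintegral_const_mul' _ _ ?_
        exact ENNReal.rpow_ne_top_of_nonneg hp₀.le (hθ.trans_lt ENNReal.one_lt_top).ne
    _ ≤ θ ^ p₀ := mul_le_of_le_one_right zero_le hmod

theorem lebesgueNorm_indicator_le (hp : ∀ x, 0 < p x) {B : Set X} (hB : MeasurableSet B)
    {M V : ℝ≥0∞} (hM₀ : M ≠ 0) (hM : M ≠ ∞) (hV₀ : V ≠ 0) (hV : V ≠ ∞)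
    (hf : ∀ x ∈ B, f x ≤ M) (hνB : ∀ x ∈ B, ν B ≤ V ^ p x) :
    lebesgueNorm ν p (B.indicator f) ≤ M * V := by
  refine lebesgueNorm_le (ENNReal.mul_pos hM₀ hV₀) (ENNReal.mul_lt_top hM.lt_top hV.lt_top) ?_
  calc lebesgueModular ν p (fun x => B.indicator f x / (M * V))
      ≤ ∫⁻ x, B.indicator (fun _ => (ν B)⁻¹) x ∂ν := by
        refine lintegral_mono fun x => ?_
        by_cases hx : x ∈ B
        · simp only [indicator_of_mem hx]
          calc (f x / (M * V)) ^ p x ≤ (V⁻¹) ^ p x := by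
                refine ENNReal.rpow_le_rpow ?_ (hp x).le
                rw [ENNReal.div_le_iff (mul_ne_zero hM₀ hV₀) (ENNReal.mul_ne_top hM hV),
                  mul_left_comm, ENNReal.inv_mul_cancel hV₀ hV, mul_one]
                exact hf x hx
            _ = (V ^ p x)⁻¹ := ENNReal.inv_rpow _ _
            _ ≤ (ν B)⁻¹ := ENNReal.inv_le_inv.mpr (hνB x hx)
        · simp [indicator_of_notMem hx, hp x]
    _ = (ν B)⁻¹ * ν B := lintegral_indicator_const hB _
    _ ≤ 1 := ENNReal.inv_mul_le_one _

theorem mul_rpow_le_lebesgueNorm {F : Set X} (hF : MeasurableSet F) {η m : ℝ≥0∞} {G : ℝ}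
    (hG : 0 < G) (hp : ∀ x ∈ F, G⁻¹ ≤ p x) (hf : ∀ x ∈ F, η ≤ f x) (hmF : m ≤ ν F)
    (hm : m ≤ 1) : η * m ^ G ≤ lebesgueNorm ν p f := by
  refine le_sInf fun t ⟨ht₀, ht, hmod⟩ => ?_
  rcases le_total η t with hηt | hηt
  · exact mul_le_of_le_of_le_one hηt (ENNReal.rpow_le_one hm hG.le)
  have hone : 1 ≤ η / t := by rwa [ENNReal.le_div_iff_mul_le (.inl ht₀.ne') (.inl ht.ne), one_mul]
  have hmass : (η / t) ^ G⁻¹ * m ≤ 1 :=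
    calc (η / t) ^ G⁻¹ * m ≤ ∫⁻ _ in F, (η / t) ^ G⁻¹ ∂ν := by
          rw [setLIntegral_const]; gcongr
      _ ≤ ∫⁻ x in F, (f x / t) ^ p x ∂ν := by
          refine setLIntegral_mono' hF fun x hx => ?_
          calc (η / t) ^ G⁻¹ ≤ (η / t) ^ p x :=
                ENNReal.rpow_le_rpow_of_exponent_le hone (hp x hx)
            _ ≤ (f x / t) ^ p x :=
                ENNReal.rpow_le_rpow (ENNReal.div_le_div_right (hf x hx) t)
                  ((inv_pos.mpr hG).le.trans (hp x hx))
      _ ≤ lebesgueModular ν p (fun x => f x / t) := setLIntegral_le_lintegral _ _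
      _ ≤ 1 := hmod
  calc η * m ^ G = t * ((η / t) ^ G⁻¹ * m) ^ G := by
        rw [ENNReal.mul_rpow_of_nonneg _ _ hG.le, ENNReal.rpow_inv_rpow hG.ne', ← mul_assoc,
          ENNReal.mul_div_cancel ht₀.ne' ht.ne]
    _ ≤ t := mul_le_of_le_one_right zero_le (ENNReal.rpow_le_one hmass hG.le)

theorem toReal_inv_le_inv_of_ofReal_le {q₀ : ℝ} (hq₀ : 0 < q₀) {r : ℝ≥0∞}
    (h : ENNReal.ofReal q₀ ≤ r) : (r⁻¹).toReal ≤ q₀⁻¹ := by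
  rw [← ENNReal.toReal_ofReal (inv_pos.mpr hq₀).le, ENNReal.ofReal_inv_of_pos hq₀]
  exact ENNReal.toReal_mono (by simpa using hq₀) (ENNReal.inv_le_inv.mpr h)

theorem le_seqNorm {r : ℝ≥0∞} (hr : r ≠ 0) (a : ℤ → ℝ≥0∞) (k : ℤ) : a k ≤ seqNorm r a := by
  unfold seqNorm
  split_ifs with hr_top
  · exact le_iSup a k
  · have hr_pos : 0 < r.toReal := ENNReal.toReal_pos hr hr_top
    rw [one_div, ENNReal.le_rpow_inv_iff hr_pos]
    exact ENNReal.le_tsum k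

theorem le_one_of_tsum_rpow_le_one {q₀ : ℝ} (hq₀ : 0 < q₀) {c : ℤ → ℝ≥0∞}
    (hc : ∑' k, c k ^ q₀ ≤ 1) (k : ℤ) : c k ≤ 1 :=
  not_lt.mp fun hk => (ENNReal.one_lt_rpow hk hq₀).not_ge ((ENNReal.le_tsum k).trans hc)

theorem seqNorm_le_of_le_mul {q₀ : ℝ} (hq₀ : 0 < q₀) {r h : ℝ≥0∞} (hr : ENNReal.ofReal q₀ ≤ r)
    {a c : ℤ → ℝ≥0∞} (hc : ∑' k, c k ^ q₀ ≤ 1) (ha : ∀ k, a k ≤ c k * h) :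
    seqNorm r a ≤ h := by
  have hc_le := le_one_of_tsum_rpow_le_one hq₀ hc
  unfold seqNorm
  split_ifs with hr_top
  · exact iSup_le fun k => (ha k).trans (mul_le_of_le_one_left zero_le (hc_le k))
  have hq₀r : q₀ ≤ r.toReal := (ENNReal.ofReal_le_iff_le_toReal hr_top).mp hr
  have hr_pos : 0 < r.toReal := hq₀.trans_le hq₀r
  rw [one_div, ENNReal.rpow_inv_le_iff hr_pos]
  calc ∑' k, a k ^ r.toReal ≤ ∑' k, c k ^ q₀ * h ^ r.toReal := by
        refine ENNReal.tsum_le_tsum fun k => ?_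
        calc a k ^ r.toReal ≤ (c k * h) ^ r.toReal := ENNReal.rpow_le_rpow (ha k) hr_pos.le
          _ = c k ^ r.toReal * h ^ r.toReal := ENNReal.mul_rpow_of_nonneg _ _ hr_pos.le
          _ ≤ c k ^ q₀ * h ^ r.toReal := by
              gcongr ?_ * _
              exact ENNReal.rpow_le_rpow_of_exponent_ge (hc_le k) hq₀r
    _ = (∑' k, c k ^ q₀) * h ^ r.toReal := ENNReal.tsum_mul_right
    _ ≤ h ^ r.toReal := mul_le_of_le_one_left zero_le hc

theorem seqLebesgueNorm_le_lebesgueNorm_of_tsum_le (hp : ∀ x, 0 ≤ p x) {q₀ : ℝ} (hq₀ : 0 < q₀)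
    (hq : ∀ᵐ x ∂ν, ENNReal.ofReal q₀ ≤ q x) {g : ℤ → X → ℝ≥0∞} {c : ℤ → ℝ≥0∞}
    (hc_pos : ∀ k, 0 < c k) (hc : ∑' k, c k ^ q₀ ≤ 1) (hg : ∀ᵐ x ∂ν, ∀ k, g k x ≤ c k * f x) :
    seqLebesgueNorm ν p q g ≤ lebesgueNorm ν p f := by
  refine le_sInf fun T ⟨hT₀, hT, hmod⟩ =>
    sInf_le ⟨hT₀, hT, (ENNReal.tsum_le_tsum fun k => ?_).trans hc⟩
  have hcq : c k ^ q₀ ≤ 1 := (ENNReal.le_tsum k).trans hc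
  have hck : c k ≤ 1 := le_one_of_tsum_rpow_le_one hq₀ hc k
  have hck_top : c k ≠ ∞ := (hck.trans_lt ENNReal.one_lt_top).ne
  refine sInf_le ⟨ENNReal.rpow_pos (hc_pos k) hck_top, hcq.trans_lt ENNReal.one_lt_top,
    (lebesgueModular_mono_ae hp ?_).trans hmod⟩
  filter_upwards [hq, hg] with x hqx hgx
  have hck_le : c k ≤ (c k ^ q₀) ^ ((q x)⁻¹).toReal := by
    rw [← ENNReal.rpow_mul]
    refine (ENNReal.rpow_one (c k)).symm.le.trans (ENNReal.rpow_le_rpow_of_exponent_ge hck ?_)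
    calc q₀ * ((q x)⁻¹).toReal ≤ q₀ * q₀⁻¹ := by
          gcongr; exact toReal_inv_le_inv_of_ofReal_le hq₀ hqx
      _ = 1 := mul_inv_cancel₀ hq₀.ne'
  calc g k x / T / (c k ^ q₀) ^ ((q x)⁻¹).toReal ≤ c k * f x / T / c k := by
        gcongr; exact hgx k
    _ = f x / T := by
        rw [mul_div_assoc, mul_comm, ENNReal.mul_div_cancel_right (hc_pos k).ne' hck_top]

theorem gradientNorm_le_lebesgueNorm_of_tsum_le (A : HajlaszScale) (hp : ∀ x, 0 ≤ p x) {q₀ : ℝ}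
    (hq₀ : 0 < q₀) (hq : ∀ᵐ x ∂ν, ENNReal.ofReal q₀ ≤ q x) {g : ℤ → X → ℝ≥0∞} {c : ℤ → ℝ≥0∞}
    (hc_pos : ∀ k, 0 < c k) (hc : ∑' k, c k ^ q₀ ≤ 1) (hg : ∀ᵐ x ∂ν, ∀ k, g k x ≤ c k * f x) :
    gradientNorm A ν p q g ≤ lebesgueNorm ν p f := by
  cases A with
  | M =>
    refine lebesgueNorm_mono_ae hp ?_
    filter_upwards [hq, hg] with x hqx hgx
    exact seqNorm_le_of_le_mul hq₀ hqx hc hgx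
  | N => exact seqLebesgueNorm_le_lebesgueNorm_of_tsum_le hp hq₀ hq hc_pos hc hg

theorem gradientNorm_le_lebesgueNorm_of_eq_top (A : HajlaszScale) (hp : ∀ x, 0 ≤ p x)
    (hq : ∀ᵐ x ∂ν, q x = ∞) {g : ℤ → X → ℝ≥0∞} (hg : ∀ᵐ x ∂ν, ∀ k, g k x ≤ f x) :
    gradientNorm A ν p q g ≤ lebesgueNorm ν p f := by
  cases A with
  | M =>
    refine lebesgueNorm_mono_ae hp ?_
    filter_upwards [hq, hg] with x hqx hgx
    simpa only [seqNorm, hqx, if_true] using iSup_le hgx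
  | N =>
    refine le_sInf fun T ⟨hT₀, hT, hmod⟩ => sInf_le ⟨hT₀, hT, ?_⟩
    refine (ENNReal.tsum_eq_zero.mpr fun k => le_antisymm ?_ zero_le).trans_le zero_le
    -- `t ^ (1 / ∞) = 1`, so every `t > 0` is admissible in the infimum.
    refine le_of_forall_gt_imp_ge_of_dense fun ε hε => ?_
    rcases eq_or_ne ε ∞ with rfl | hε_top
    · exact le_top
    refine sInf_le ⟨hε, hε_top.lt_top, (lebesgueModular_mono_ae hp ?_).trans hmod⟩
    filter_upwards [hq, hg] with x hqx hgx
    simpa only [hqx, ENNReal.inv_top, ENNReal.toReal_zero, ENNReal.rpow_zero, div_one] using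
      ENNReal.div_le_div_right (hgx k) T

theorem lebesgueNorm_le_gradientNorm (A : HajlaszScale) (hp : ∀ x, 0 ≤ p x) {q₀ : ℝ}
    (hq₀ : 0 < q₀) (hq : ∀ᵐ x ∂ν, ENNReal.ofReal q₀ ≤ q x) (g : ℤ → X → ℝ≥0∞) (k : ℤ) :
    lebesgueNorm ν p (g k) ≤ gradientNorm A ν p q g := by
  cases A with
  | M =>
    refine lebesgueNorm_mono_ae hp (hq.mono fun x hx => ?_)
    exact le_seqNorm ((ENNReal.ofReal_pos.mpr hq₀).trans_le hx).ne' (fun j => g j x) k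
  | N =>
    refine le_sInf fun t ⟨ht₀, ht, hmod⟩ => le_of_forall_gt_imp_ge_of_dense fun T hT => ?_
    rcases eq_or_ne T ∞ with rfl | hT_top
    · exact le_top
    have hθ : 1 < (T / t) ^ q₀ := by
      refine ENNReal.one_lt_rpow ?_ hq₀
      rwa [ENNReal.lt_div_iff_mul_lt (.inl ht₀.ne') (.inl ht.ne), one_mul]
    obtain ⟨τ, ⟨-, -, hτmod⟩, hτ⟩ := sInf_lt_iff.mp (((ENNReal.le_tsum k).trans hmod).trans_lt hθ)
    refine lebesgueNorm_le (ht₀.trans hT) hT_top.lt_top (le_trans ?_ hτmod)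
    refine lebesgueModular_mono_ae hp (hq.mono fun x hx => ?_)
    have hτ_le : τ ^ ((q x)⁻¹).toReal ≤ T / t :=
      calc τ ^ ((q x)⁻¹).toReal ≤ ((T / t) ^ q₀) ^ ((q x)⁻¹).toReal :=
            ENNReal.rpow_le_rpow hτ.le ENNReal.toReal_nonneg
        _ ≤ ((T / t) ^ q₀) ^ q₀⁻¹ :=
            ENNReal.rpow_le_rpow_of_exponent_le hθ.le (toReal_inv_le_inv_of_ofReal_le hq₀ hx)
        _ = T / t := ENNReal.rpow_rpow_inv hq₀.ne' _
    calc g k x / T = g k x / t / (T / t) := by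
          rw [div_eq_mul_inv _ t, div_eq_mul_inv _ (T / t), mul_assoc,
            ← ENNReal.mul_inv (.inl ht₀.ne') (.inl ht.ne), ENNReal.mul_div_cancel ht₀.ne' ht.ne,
            div_eq_mul_inv]
      _ ≤ g k x / t / τ ^ ((q x)⁻¹).toReal := by gcongr

end Norms

/-! ### Radial bumps -/

section Bump

variable {X : Type*} [MetricSpace X]

/-- The radial cut-off function of the pair of concentric balls `B(z,a) ⊆ B(z,b)`: it is `1` on
`closedBall z a`, `0` off `ball z b`, and affine in the distance to `z` in between. It is the test
function for all the embeddings. -/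
noncomputable def radialBump (z : X) (a b : ℝ) (y : X) : ℝ :=
  max 0 (min 1 ((b - dist y z) / (b - a)))

/-- The size `(b - a) ^ (-s(·))` on `B(z,b)` of the smoothness `s(·)` gradients of
`radialBump z a b`. -/
noncomputable def bumpProfile (s : X → ℝ) (z : X) (a b : ℝ) : X → ℝ≥0∞ :=
  (Metric.ball z b).indicator fun y => ENNReal.ofReal ((b - a) ^ (-s y))

/-- A vector `s(·)`-gradient of `radialBump z a b`. Its `k`-th entry combines the Lipschitz bound
`2 ^ (-k) / (b - a)` and the trivial bound `1` for the increments of the bump over distances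
`2 ^ (-k - 1) ≤ d < 2 ^ (-k)`. -/
noncomputable def bumpGradient (s : X → ℝ) (z : X) (a b : ℝ) (k : ℤ) : X → ℝ≥0∞ :=
  (Metric.ball z b).indicator fun y =>
    ENNReal.ofReal (min (1 / ((2 : ℝ) ^ k * (b - a))) 1 * ((2 : ℝ) ^ (k + 1)) ^ s y)

theorem radialBump_nonneg (z : X) (a b : ℝ) (y : X) : 0 ≤ radialBump z a b y := le_max_left _ _

theorem radialBump_le_one (z : X) (a b : ℝ) (y : X) : radialBump z a b y ≤ 1 :=
  max_le zero_le_one (min_le_left _ _)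

theorem continuous_radialBump (z : X) (a b : ℝ) : Continuous (radialBump z a b) := by
  unfold radialBump
  fun_prop

variable {z : X} {a b : ℝ}

theorem radialBump_eq_one (hab : a < b) {y : X} (hy : y ∈ Metric.closedBall z a) :
    radialBump z a b y = 1 := by
  have hone : 1 ≤ (b - dist y z) / (b - a) := by
    rw [le_div_iff₀ (sub_pos.mpr hab)]
    linarith [Metric.mem_closedBall.mp hy]
  rw [radialBump, min_eq_left hone, max_eq_right zero_le_one]

theorem radialBump_eq_zero (hab : a < b) {y : X} (hy : y ∉ Metric.ball z b) :
    radialBump z a b y = 0 := by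
  rw [Metric.mem_ball, not_lt] at hy
  exact max_eq_left <| (min_le_right _ _).trans <|
    div_nonpos_of_nonpos_of_nonneg (by linarith) (by linarith)

theorem abs_radialBump_sub_le_one (x y : X) : |radialBump z a b x - radialBump z a b y| ≤ 1 := by
  simpa only [Real.dist_eq, sub_zero] using Real.dist_le_of_mem_Icc_01
    ⟨radialBump_nonneg z a b x, radialBump_le_one z a b x⟩
    ⟨radialBump_nonneg z a b y, radialBump_le_one z a b y⟩

theorem abs_radialBump_sub_le (hab : a < b) (x y : X) :
    |radialBump z a b x - radialBump z a b y| ≤ dist x y / (b - a) := by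
  have hL : 0 < b - a := sub_pos.mpr hab
  have haffine : |(b - dist x z) / (b - a) - (b - dist y z) / (b - a)| ≤ dist x y / (b - a) := by
    rw [← sub_div, abs_div, abs_of_pos hL, sub_sub_sub_cancel_left, dist_comm x y]
    gcongr
    exact abs_dist_sub_le y x z
  refine (abs_max_sub_max_le_max _ _ _ _).trans ?_
  rw [sub_self, abs_zero]
  refine max_le (by positivity) ((abs_min_sub_min_le_max _ _ _ _).trans ?_)
  rw [sub_self, abs_zero]
  exact max_le (by positivity) haffine

variable {s : X → ℝ}

theorem ofReal_abs_radialBump_sub_le_mul_bumpGradient (hab : a < b) {k : ℤ} {x y w : X}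
    (hsw : 0 ≤ s w) (hxy : (2 : ℝ) ^ (-k - 1) ≤ dist x y) (hxy' : dist x y < (2 : ℝ) ^ (-k))
    (hw : w ∈ Metric.ball z b) :
    ENNReal.ofReal |radialBump z a b x - radialBump z a b y| ≤
      ENNReal.ofReal (dist x y ^ s w) * bumpGradient s z a b k w := by
  have hL : 0 < b - a := sub_pos.mpr hab
  rw [bumpGradient, indicator_of_mem hw, ← ENNReal.ofReal_mul (by positivity)]
  refine ENNReal.ofReal_le_ofReal ?_
  have hscale : 1 ≤ dist x y ^ s w * ((2 : ℝ) ^ (k + 1)) ^ s w := by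
    rw [← Real.mul_rpow dist_nonneg (by positivity)]
    refine Real.one_le_rpow ?_ hsw
    calc (1 : ℝ) = (2 : ℝ) ^ (-k - 1) * (2 : ℝ) ^ (k + 1) := by
          rw [← zpow_add₀ two_ne_zero]; simp
      _ ≤ _ := by gcongr
  have hincr : |radialBump z a b x - radialBump z a b y| ≤
      min (1 / ((2 : ℝ) ^ k * (b - a))) 1 := by
    refine le_min ((abs_radialBump_sub_le hab x y).trans ?_) (abs_radialBump_sub_le_one ..)
    rw [div_le_div_iff₀ hL (by positivity), one_mul, ← mul_assoc]
    refine mul_le_of_le_one_left hL.le ?_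
    calc dist x y * (2 : ℝ) ^ k ≤ (2 : ℝ) ^ (-k) * (2 : ℝ) ^ k := by gcongr
      _ = 1 := by rw [← zpow_add₀ two_ne_zero]; simp
  calc |radialBump z a b x - radialBump z a b y|
      ≤ min (1 / ((2 : ℝ) ^ k * (b - a))) 1 := hincr
    _ ≤ min (1 / ((2 : ℝ) ^ k * (b - a))) 1 * (dist x y ^ s w * ((2 : ℝ) ^ (k + 1)) ^ s w) :=
        le_mul_of_one_le_right (by positivity) hscale
    _ = dist x y ^ s w * (min (1 / ((2 : ℝ) ^ k * (b - a))) 1 * ((2 : ℝ) ^ (k + 1)) ^ s w) := by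
        ring

theorem bumpGradient_le_mul_bumpProfile (hab : a < b) {k : ℤ} {y : X} (hsy : s y ≤ 1) {C : ℝ}
    (hC : min (1 / ((2 : ℝ) ^ k * (b - a))) 1 * ((2 : ℝ) ^ k * (b - a)) ^ s y ≤ C) :
    bumpGradient s z a b k y ≤ ENNReal.ofReal (2 * C) * bumpProfile s z a b y := by
  by_cases hy : y ∈ Metric.ball z b
  swap
  · simp only [bumpGradient, indicator_of_notMem hy, zero_le]
  have hL : 0 < b - a := sub_pos.mpr hab
  have hC₀ : 0 ≤ C := le_trans (by positivity) hC
  rw [bumpGradient, bumpProfile, indicator_of_mem hy, indicator_of_mem hy,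
    ← ENNReal.ofReal_mul (by positivity)]
  refine ENNReal.ofReal_le_ofReal ?_
  calc min (1 / ((2 : ℝ) ^ k * (b - a))) 1 * ((2 : ℝ) ^ (k + 1)) ^ s y
      = 2 ^ s y * (min (1 / ((2 : ℝ) ^ k * (b - a))) 1 * ((2 : ℝ) ^ k * (b - a)) ^ s y) *
          (b - a) ^ (-s y) := by
        rw [Real.mul_rpow (by positivity) hL.le, zpow_add_one₀ two_ne_zero,
          Real.mul_rpow (by positivity) zero_le_two, Real.rpow_neg hL.le]
        field_simp
    _ ≤ 2 * C * (b - a) ^ (-s y) := by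
        gcongr
        exact Real.rpow_le_self_of_one_le one_le_two hsy

theorem min_inv_one_mul_rpow_le_one {τ σ : ℝ} (hτ : 0 < τ) (hσ₀ : 0 ≤ σ) (hσ : σ ≤ 1) :
    min (1 / τ) 1 * τ ^ σ ≤ 1 := by
  rcases le_total τ 1 with h | h
  · exact mul_le_one₀ (min_le_right _ _) (by positivity) (Real.rpow_le_one hτ.le h hσ₀)
  · calc min (1 / τ) 1 * τ ^ σ ≤ 1 / τ * τ ^ (1 : ℝ) := by
          gcongr
          exact min_le_left _ _
      _ = 1 := by rw [Real.rpow_one, one_div_mul_cancel hτ.ne']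

theorem min_inv_one_mul_rpow_le_pow_natAbs {τ σ η : ℝ} {j : ℤ} (hη : η ≤ σ) (hησ : η ≤ 1 - σ)
    (hη₀ : 0 ≤ η) (hjτ : (2 : ℝ) ^ j ≤ τ) (hτj : τ < (2 : ℝ) ^ (j + 1)) :
    min (1 / τ) 1 * τ ^ σ ≤ 2 * ((2 : ℝ) ^ (-η)) ^ j.natAbs := by
  have hτ : 0 < τ := lt_of_lt_of_le (by positivity) hjτ
  have hpow : ((2 : ℝ) ^ (-η)) ^ j.natAbs = 2 ^ (-(η * |(j : ℝ)|)) := by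
    rw [← Real.rpow_natCast, ← Real.rpow_mul zero_le_two, Nat.cast_natAbs, Int.cast_abs, neg_mul]
  rw [hpow]
  rcases le_or_gt 0 j with hj | hj
  · have hj' : (0 : ℝ) ≤ j := by exact_mod_cast hj
    calc min (1 / τ) 1 * τ ^ σ ≤ 1 / τ * τ ^ σ := by gcongr; exact min_le_left _ _
      _ = τ ^ (σ - 1) := by rw [Real.rpow_sub_one hτ.ne', one_div_mul_eq_div]
      _ ≤ ((2 : ℝ) ^ (j : ℝ)) ^ (σ - 1) := by
          refine Real.rpow_le_rpow_of_nonpos (by positivity) ?_ (by linarith)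
          rwa [Real.rpow_intCast]
      _ = 2 ^ ((j : ℝ) * (σ - 1)) := (Real.rpow_mul zero_le_two _ _).symm
      _ ≤ 2 ^ (-(η * |(j : ℝ)|)) := by
          refine Real.rpow_le_rpow_of_exponent_le one_le_two ?_
          rw [abs_of_nonneg hj']
          nlinarith
      _ ≤ 2 * 2 ^ (-(η * |(j : ℝ)|)) := le_mul_of_one_le_left (by positivity) one_le_two
  · have hj' : (j : ℝ) < 0 := by exact_mod_cast hj
    calc min (1 / τ) 1 * τ ^ σ ≤ τ ^ σ := mul_le_of_le_one_left (by positivity) (min_le_right _ _)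
      _ ≤ ((2 : ℝ) ^ ((j : ℝ) + 1)) ^ σ := by
          refine Real.rpow_le_rpow hτ.le ?_ (by linarith)
          exact_mod_cast hτj.le
      _ = 2 ^ (((j : ℝ) + 1) * σ) := (Real.rpow_mul zero_le_two _ _).symm
      _ ≤ 2 ^ (1 + -(η * |(j : ℝ)|)) := by
          refine Real.rpow_le_rpow_of_exponent_le one_le_two ?_
          rw [abs_of_neg hj']
          nlinarith
      _ = 2 * 2 ^ (-(η * |(j : ℝ)|)) := by rw [Real.rpow_add two_pos, Real.rpow_one]

theorem summable_pow_natAbs {w : ℝ} (hw₀ : 0 ≤ w) (hw : w < 1) :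
    Summable fun j : ℤ => w ^ j.natAbs := by
  refine Summable.of_nat_of_neg ?_ ?_ <;> simpa using summable_geometric_of_lt_one hw₀ hw

theorem exists_tsum_rpow_mul_pow_natAbs_le_one {w q₀ : ℝ} (hw₀ : 0 < w) (hw : w < 1)
    (hq₀ : 0 < q₀) : ∃ c : ℝ, 0 < c ∧
      ∀ n : ℤ, ∑' k : ℤ, ENNReal.ofReal (c * w ^ (k + n).natAbs) ^ q₀ ≤ 1 := by
  have hsum := summable_pow_natAbs (Real.rpow_nonneg hw₀.le q₀) (Real.rpow_lt_one hw₀.le hw hq₀)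
  set S := ∑' j : ℤ, (w ^ q₀) ^ j.natAbs
  have hS : 0 ≤ S := tsum_nonneg fun j => by positivity
  refine ⟨(1 + S) ^ (-q₀⁻¹), by positivity, fun n => ?_⟩
  have hentry (j : ℤ) : ENNReal.ofReal ((1 + S) ^ (-q₀⁻¹) * w ^ j.natAbs) ^ q₀ =
      ENNReal.ofReal ((1 + S)⁻¹ * (w ^ q₀) ^ j.natAbs) := by
    rw [ENNReal.ofReal_rpow_of_pos (by positivity), Real.mul_rpow (by positivity) (by positivity),
      ← Real.rpow_mul (by positivity), neg_mul, inv_mul_cancel₀ hq₀.ne', Real.rpow_neg_one,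
      ← Real.rpow_natCast_mul hw₀.le, mul_comm _ q₀, Real.rpow_mul_natCast hw₀.le]
  calc ∑' k : ℤ, ENNReal.ofReal ((1 + S) ^ (-q₀⁻¹) * w ^ (k + n).natAbs) ^ q₀
      = ∑' j : ℤ, ENNReal.ofReal ((1 + S)⁻¹ * (w ^ q₀) ^ j.natAbs) := by
        simp only [hentry]
        exact (Equiv.addRight n).tsum_eq
          fun j : ℤ => ENNReal.ofReal ((1 + S)⁻¹ * (w ^ q₀) ^ j.natAbs)
    _ = ENNReal.ofReal ((1 + S)⁻¹ * S) := by
        rw [← ENNReal.ofReal_tsum_of_nonneg (fun j => by positivity) (hsum.mul_left _),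
          tsum_mul_left]
    _ ≤ 1 := by
        rw [ENNReal.ofReal_le_one, inv_mul_le_iff₀ (by positivity)]
        linarith

variable [MeasurableSpace X] [BorelSpace X] {μ : Measure X} {p : X → ℝ} {q : X → ℝ≥0∞}

theorem isVectorGradient_bumpGradient (hsm : Measurable s) (hs : ∀ x, 0 ≤ s x) (hab : a < b)
    (E : Set X) : IsVectorGradient μ s E (radialBump z a b) (bumpGradient s z a b) := by
  refine ⟨fun k => Measurable.indicator (by fun_prop) Metric.isOpen_ball.measurableSet,
    ∅, measure_empty, fun k x _ y _ hxy hxy' => ?_⟩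
  by_cases hx : x ∈ Metric.ball z b
  · exact (ofReal_abs_radialBump_sub_le_mul_bumpGradient hab (hs x) hxy hxy' hx).trans le_self_add
  by_cases hy : y ∈ Metric.ball z b
  · exact (ofReal_abs_radialBump_sub_le_mul_bumpGradient hab (hs y) hxy hxy' hy).trans le_add_self
  · simp [radialBump_eq_zero hab hx, radialBump_eq_zero hab hy]

theorem homNorm_radialBump_le_of_eq_top (A : HajlaszScale) (hp : ∀ x, 0 ≤ p x)
    (hsm : Measurable s) (hs₀ : ∀ x, 0 ≤ s x) (hs₁ : ∀ x, s x ≤ 1) (hq : ∀ᵐ x ∂μ, q x = ∞)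
    (hab : a < b) (E : Set X) :
    homNorm A μ s p q E (radialBump z a b) ≤ 2 * lebesgueNorm μ p (bumpProfile s z a b) := by
  have hL : 0 < b - a := sub_pos.mpr hab
  calc homNorm A μ s p q E (radialBump z a b)
      ≤ gradientNorm A (μ.restrict E) p q (bumpGradient s z a b) :=
        iInf₂_le _ (isVectorGradient_bumpGradient hsm hs₀ hab E)
    _ ≤ lebesgueNorm (μ.restrict E) p fun y => 2 * bumpProfile s z a b y := by
        refine gradientNorm_le_lebesgueNorm_of_eq_top A hp (ae_restrict_of_ae hq)
          (.of_forall fun y k => ?_)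
        simpa using bumpGradient_le_mul_bumpProfile hab (hs₁ y)
          (min_inv_one_mul_rpow_le_one (by positivity) (hs₀ y) (hs₁ y))
    _ ≤ lebesgueNorm μ p fun y => 2 * bumpProfile s z a b y :=
        lebesgueNorm_mono_measure Measure.restrict_le_self
    _ ≤ 2 * lebesgueNorm μ p (bumpProfile s z a b) :=
        lebesgueNorm_const_mul_le two_ne_zero ENNReal.ofNat_ne_top

theorem exists_homNorm_radialBump_le_of_lt_one (A : HajlaszScale) (hp : ∀ x, 0 ≤ p x)
    (hsm : Measurable s) {s₀ s₁ : ℝ} (hs₀ : 0 < s₀) (hs₀s : ∀ x, s₀ ≤ s x) (hs₁ : s₁ < 1)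
    (hss₁ : ∀ x, s x ≤ s₁) {q₀ : ℝ} (hq₀ : 0 < q₀) (hq : ∀ᵐ x ∂μ, ENNReal.ofReal q₀ ≤ q x) :
    ∃ K : ℝ, 0 < K ∧ ∀ (z : X) (a b : ℝ), a < b → ∀ E : Set X,
      homNorm A μ s p q E (radialBump z a b) ≤
        ENNReal.ofReal K * lebesgueNorm μ p (bumpProfile s z a b) := by
  have hs (x : X) : 0 ≤ s x := hs₀.le.trans (hs₀s x)
  obtain ⟨η, hη₀, hη⟩ : ∃ η, 0 < η ∧ η ≤ min s₀ (1 - s₁) :=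
    ⟨_, lt_min hs₀ (sub_pos.mpr hs₁), le_rfl⟩
  obtain ⟨c, hc₀, hc⟩ := exists_tsum_rpow_mul_pow_natAbs_le_one
    (Real.rpow_pos_of_pos two_pos (-η))
    (Real.rpow_lt_one_of_one_lt_of_neg one_lt_two (neg_lt_zero.mpr hη₀)) hq₀
  refine ⟨4 / c, by positivity, fun z a b hab E => ?_⟩
  have hL : 0 < b - a := sub_pos.mpr hab
  obtain ⟨n, hnL, hLn⟩ := exists_mem_Ico_zpow hL one_lt_two
  calc homNorm A μ s p q E (radialBump z a b)
      ≤ gradientNorm A (μ.restrict E) p q (bumpGradient s z a b) :=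
        iInf₂_le _ (isVectorGradient_bumpGradient hsm hs hab E)
    _ ≤ lebesgueNorm (μ.restrict E) p fun y =>
          ENNReal.ofReal (4 / c) * bumpProfile s z a b y := by
        refine gradientNorm_le_lebesgueNorm_of_tsum_le A hp hq₀ (ae_restrict_of_ae hq)
          (fun k => ENNReal.ofReal_pos.mpr (by positivity)) (hc n) (.of_forall fun y k => ?_)
        have hdecay := min_inv_one_mul_rpow_le_pow_natAbs (j := k + n) (τ := 2 ^ k * (b - a))
          (hη.trans ((min_le_left _ _).trans (hs₀s y)))
          (hη.trans ((min_le_right _ _).trans (by linarith [hss₁ y]))) hη₀.le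
          (by rw [zpow_add₀ two_ne_zero]; gcongr)
          (by rw [add_assoc, zpow_add₀ two_ne_zero k]; gcongr)
        refine (bumpGradient_le_mul_bumpProfile hab ((hss₁ y).trans hs₁.le) hdecay).trans_eq ?_
        rw [← mul_assoc (ENNReal.ofReal _) (ENNReal.ofReal _), ← ENNReal.ofReal_mul (by positivity)]
        congr 2
        field_simp
        norm_num
    _ ≤ lebesgueNorm μ p fun y => ENNReal.ofReal (4 / c) * bumpProfile s z a b y :=
        lebesgueNorm_mono_measure Measure.restrict_le_self
    _ ≤ ENNReal.ofReal (4 / c) * lebesgueNorm μ p (bumpProfile s z a b) :=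
        lebesgueNorm_const_mul_le (by simpa using hc₀) ENNReal.ofReal_ne_top

end Bump

/-! ### Log-Hölder continuous exponents -/

section Exponents

theorem IsExponent.exists_ofReal_le {X : Type*} [MeasurableSpace X] {μ : Measure X}
    {q : X → ℝ≥0∞} (hq : IsExponent μ q) :
    ∃ q₀ : ℝ, 0 < q₀ ∧ ∀ᵐ x ∂μ, ENNReal.ofReal q₀ ≤ q x := by
  have htop : min (essInf q μ) 1 ≠ ∞ := ((min_le_right _ _).trans_lt ENNReal.one_lt_top).ne
  refine ⟨(min (essInf q μ) 1).toReal,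
    ENNReal.toReal_pos (lt_min hq.2.2 one_pos).ne' htop, ?_⟩
  filter_upwards [ae_essInf_le (f := q) (μ := μ)] with x hx
  rw [ENNReal.ofReal_toReal htop]
  exact (min_le_left _ _).trans hx

variable {X : Type*} [MetricSpace X]

theorem LogHolder.exists_abs_sub_le {f : X → ℝ} (hf : LogHolder f) :
    ∃ C : ℝ, 0 < C ∧ ∀ (x y : X) (r : ℝ), 0 < r → r < 1 → dist x y < r →
      |f x - f y| ≤ C / Real.log (1 / r) := by
  obtain ⟨C, hC, h⟩ := hf
  refine ⟨C, hC, fun x y r hr hr1 hxy => ?_⟩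
  have hlog : 0 < Real.log (1 / r) := Real.log_pos (one_lt_one_div hr hr1)
  rcases eq_or_ne x y with rfl | hne
  · simpa using (div_pos hC hlog).le
  · have hd : 0 < dist x y := dist_pos.mpr hne
    refine (h x y hne).trans ?_
    gcongr
    calc 1 / r ≤ 1 / dist x y := by gcongr
      _ ≤ Real.exp 1 + 1 / dist x y := le_add_of_nonneg_left (Real.exp_pos 1).le

theorem exists_forall_oscillation_le {ι : Type*} [Finite ι] {f : ι → X → ℝ}
    (hf : ∀ i, LogHolder (f i)) {d₁ : ℝ} (hd₁ : 0 < d₁) :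
    ∃ C r₁ : ℝ, 0 < r₁ ∧ r₁ < 1 ∧ ∀ r, 0 < r → r ≤ r₁ → ∃ d, 0 ≤ d ∧ d ≤ d₁ ∧
      d * Real.log (1 / r) ≤ C ∧ ∀ i x y, dist x y < r → |f i x - f i y| ≤ d := by
  choose C _ h using fun i => (hf i).exists_abs_sub_le
  obtain ⟨M, hM⟩ := Finite.exists_le C
  have hM₀ : 0 ≤ max M 0 := le_max_right _ _
  refine ⟨max M 0, Real.exp (-(max M 0 / d₁ + 1)), Real.exp_pos _,
    Real.exp_lt_one_iff.mpr (neg_lt_zero.mpr (by positivity)), fun r hr hr₁ => ?_⟩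
  have hr_one : r < 1 :=
    hr₁.trans_lt (Real.exp_lt_one_iff.mpr (neg_lt_zero.mpr (by positivity)))
  have hlog : 0 < Real.log (1 / r) := Real.log_pos (one_lt_one_div hr hr_one)
  have hlog' : max M 0 / d₁ ≤ Real.log (1 / r) := by
    have := Real.log_le_log hr hr₁
    rw [Real.log_exp] at this
    rw [one_div, Real.log_inv]
    linarith
  refine ⟨max M 0 / Real.log (1 / r), by positivity, ?_, (div_mul_cancel₀ _ hlog.ne').le,
    fun i x y hxy => (h i x y r hr hr_one hxy).trans ?_⟩
  · rw [div_le_iff₀ hlog]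
    rwa [div_le_iff₀ hd₁, mul_comm] at hlog'
  · gcongr
    exact (hM i).trans (le_max_left _ _)

theorem LogHolder.continuous {f : X → ℝ} (hf : LogHolder f) : Continuous f := by
  rw [Metric.continuous_iff]
  intro x ε hε
  obtain ⟨_, r₁, hr₁, -, h⟩ :=
    exists_forall_oscillation_le (f := fun _ : Unit => f) (fun _ => hf) (half_pos hε)
  obtain ⟨d, -, hdε, -, hd⟩ := h r₁ hr₁ le_rfl
  exact ⟨r₁, hr₁, fun y hy => ((hd () y x hy).trans hdε).trans_lt (half_lt_self hε)⟩

variable [MeasurableSpace X] {μ : Measure X} {p s γ : X → ℝ} {q : X → ℝ≥0∞}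

theorem IsMetricMeasure.isOpenPosMeasure (hμ : IsMetricMeasure μ) : μ.IsOpenPosMeasure := by
  refine ⟨fun U hU ⟨x, hx⟩ hU₀ => ?_⟩
  obtain ⟨ε, hε, hsub⟩ := Metric.isOpen_iff.mp hU x hx
  exact (hμ x ε hε).1.ne' (measure_mono_null hsub hU₀)

theorem le_of_ae_le_of_continuous [μ.IsOpenPosMeasure] {f g : X → ℝ} (hf : Continuous f)
    (hg : Continuous g) (h : ∀ᵐ x ∂μ, f x ≤ g x) (x : X) : f x ≤ g x := by
  have hnull : μ {x | g x < f x} = 0 := by simpa only [ae_iff, not_le] using h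
  have hempty := ((isOpen_lt hg hf).measure_eq_zero_iff μ).mp hnull
  exact not_lt.mp fun hx => (Set.ext_iff.mp hempty x).mp hx

theorem IsBddLogExponent.continuous (hp : IsBddLogExponent μ p) : Continuous p := by
  simpa only [one_div, Pi.inv_def, inv_inv] using
    hp.2.continuous.inv₀ fun x => (one_div_pos.mpr (hp.1.2.1 x)).ne'

theorem IsBddLogExponent.exists_bounds (hμ : IsMetricMeasure μ) (hp : IsBddLogExponent μ p) :
    ∃ m M : ℝ, 0 < m ∧ 0 < M ∧ (∀ x, m ≤ p x) ∧ ∀ x, p x ≤ M := by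
  have := hμ.isOpenPosMeasure
  obtain ⟨-, -, ⟨m, hm, hmp⟩, M, hM⟩ := hp.1
  have hpM := le_of_ae_le_of_continuous hp.continuous continuous_const hM
  exact ⟨m, max M 1, hm, by positivity,
    le_of_ae_le_of_continuous continuous_const hp.continuous hmp,
    fun x => (hpM x).trans (le_max_left _ _)⟩

theorem IsBddLogExponent.logHolder (hμ : IsMetricMeasure μ) (hp : IsBddLogExponent μ p) :
    LogHolder p := by
  obtain ⟨m, M, hm, hM, hmp, hpM⟩ := hp.exists_bounds hμ
  obtain ⟨C, hC, h⟩ := hp.2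
  refine ⟨M * M * C, by positivity, fun x y hxy => ?_⟩
  have hx : 0 < p x := hm.trans_le (hmp x)
  have hy : 0 < p y := hm.trans_le (hmp y)
  have hsub : p x - p y = -(p x * p y) * (1 / p x - 1 / p y) := by field_simp; ring
  rw [hsub, abs_mul, abs_neg, abs_of_pos (by positivity), mul_div_assoc]
  gcongr
  · exact hpM x
  · exact hpM y
  · exact h x y hxy

theorem ExponentGG.exists_forall_le_one_div_sub (hμ : IsMetricMeasure μ)
    (hp : IsBddLogExponent μ p) (hγ : IsBddLogExponent μ γ) (h : ExponentGG μ γ p) :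
    ∃ κ : ℝ, 0 < κ ∧ ∀ x, κ ≤ 1 / p x - 1 / γ x := by
  have := hμ.isOpenPosMeasure
  obtain ⟨ε, hε, hae⟩ := h
  have hsub := le_of_ae_le_of_continuous continuous_const (hγ.continuous.sub hp.continuous) hae
  obtain ⟨-, P, -, hP, -, hpP⟩ := hp.exists_bounds hμ
  obtain ⟨-, G, -, hG, -, hγG⟩ := hγ.exists_bounds hμ
  refine ⟨ε / (P * G), by positivity, fun x => ?_⟩
  have hpx := hp.1.2.1 x
  have hγx := hγ.1.2.1 x
  have hεx : ε ≤ γ x - p x := hsub x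
  calc ε / (P * G) ≤ (γ x - p x) / (p x * γ x) := by
        gcongr
        · exact hε.le.trans hεx
        · exact hpP x
        · exact hγG x
    _ = 1 / p x - 1 / γ x := by field_simp

theorem SmoothnessAdmissible.exists_upper_bound (hμ : IsMetricMeasure μ) (hs : Continuous s)
    (h : SmoothnessAdmissible μ s q) :
    ∃ s₁ : ℝ, (∀ x, s x ≤ s₁) ∧ (s₁ < 1 ∨ s₁ ≤ 1 ∧ ∀ᵐ x ∂μ, q x = ∞) := by
  have := hμ.isOpenPosMeasure
  obtain ⟨hle_one, heq_one⟩ := h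
  set e := essSup (fun x => ENNReal.ofReal (s x)) μ
  have he_top : e ≠ ∞ := (hle_one.trans_lt ENNReal.one_lt_top).ne
  refine ⟨e.toReal, le_of_ae_le_of_continuous (μ := μ) hs continuous_const ?_, ?_⟩
  · filter_upwards [ENNReal.ae_le_essSup (μ := μ) fun x => ENNReal.ofReal (s x)] with x hx
    exact (ENNReal.ofReal_le_iff_le_toReal he_top).mp hx
  rcases hle_one.lt_or_eq with hlt | heq
  · left
    simpa using (ENNReal.toReal_lt_toReal he_top ENNReal.one_ne_top).mpr hlt
  · refine .inr ⟨by simp [heq], ?_⟩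
    filter_upwards [ae_essInf_le (f := q) (μ := μ)] with x hx
    exact top_le_iff.mp (heq_one heq ▸ hx)

theorem exists_homNorm_radialBump_le [BorelSpace X] (A : HajlaszScale) (hμ : IsMetricMeasure μ)
    (hp : ∀ x, 0 ≤ p x) (hs : IsBddLogExponent μ s) (hq : IsExponent μ q)
    (hsq : SmoothnessAdmissible μ s q) :
    ∃ K : ℝ, 0 < K ∧ ∀ (z : X) (a b : ℝ), a < b → ∀ E : Set X,
      homNorm A μ s p q E (radialBump z a b) ≤
        ENNReal.ofReal K * lebesgueNorm μ p (bumpProfile s z a b) := by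
  obtain ⟨s₀, -, hs₀, -, hs₀s, -⟩ := hs.exists_bounds hμ
  obtain ⟨s₁, hss₁, hs₁ | ⟨hs₁, hq_top⟩⟩ := hsq.exists_upper_bound hμ hs.continuous
  · obtain ⟨q₀, hq₀, hq₀q⟩ := hq.exists_ofReal_le
    exact exists_homNorm_radialBump_le_of_lt_one A hp hs.1.1 hs₀ hs₀s hs₁ hss₁ hq₀ hq₀q
  · refine ⟨2, two_pos, fun z a b hab E => ?_⟩
    rw [ENNReal.ofReal_ofNat]
    exact homNorm_radialBump_le_of_eq_top A hp hs.1.1 (fun x => hs₀.le.trans (hs₀s x))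
      (fun x => (hss₁ x).trans hs₁) hq_top hab E

theorem lebesgueNorm_bumpProfile_le [BorelSpace X] (hp : ∀ x, 0 < p x) {z : X} {a b : ℝ}
    (hab : a < b) (hba : b - a ≤ 1) {S V : ℝ} (hs : ∀ y ∈ Metric.ball z b, s y ≤ S) (hV : 0 < V)
    (hμV : ∀ y ∈ Metric.ball z b, μ (Metric.ball z b) ≤ ENNReal.ofReal (V ^ p y)) :
    lebesgueNorm μ p (bumpProfile s z a b) ≤ ENNReal.ofReal ((b - a) ^ (-S) * V) := by
  have hL : 0 < b - a := sub_pos.mpr hab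
  rw [ENNReal.ofReal_mul (by positivity)]
  refine lebesgueNorm_indicator_le hp Metric.isOpen_ball.measurableSet
    (ENNReal.ofReal_pos.mpr (by positivity)).ne' ENNReal.ofReal_ne_top
    (ENNReal.ofReal_pos.mpr hV).ne' ENNReal.ofReal_ne_top
    (fun y hy => ENNReal.ofReal_le_ofReal ?_) fun y hy => ?_
  · exact Real.rpow_le_rpow_of_exponent_ge hL hba (neg_le_neg (hs y hy))
  · rw [ENNReal.ofReal_rpow_of_pos hV]
    exact hμV y hy

end Exponents

/-! ### Iteration over radii that halve the measure -/

section Iteration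

variable {X : Type*} [MetricSpace X] [MeasurableSpace X] {μ : Measure X}

theorem IsMetricMeasure.measure_ball_ne_top (hμ : IsMetricMeasure μ) (x : X) (r : ℝ) :
    μ (Metric.ball x r) ≠ ∞ := by
  rcases le_or_gt r 0 with hr | hr
  · simp [Metric.ball_eq_empty.mpr hr]
  · exact (hμ x r hr).2.ne

theorem IsMetricMeasure.measure_closedBall_ne_top (hμ : IsMetricMeasure μ) (x : X) (r : ℝ) :
    μ (Metric.closedBall x r) ≠ ∞ :=
  measure_ne_top_of_subset (Metric.closedBall_subset_ball (lt_add_one r))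
    (hμ.measure_ball_ne_top x _)

theorem IsMetricMeasure.real_ball_pos (hμ : IsMetricMeasure μ) (x : X) {r : ℝ} (hr : 0 < r) :
    0 < μ.real (Metric.ball x r) :=
  ENNReal.toReal_pos (hμ x r hr).1.ne' (hμ.measure_ball_ne_top x r)

theorem IsMetricMeasure.ofReal_real_ball (hμ : IsMetricMeasure μ) (x : X) (r : ℝ) :
    ENNReal.ofReal (μ.real (Metric.ball x r)) = μ (Metric.ball x r) :=
  ofReal_measureReal (hμ.measure_ball_ne_top x r)

theorem IsMetricMeasure.ofReal_real_closedBall (hμ : IsMetricMeasure μ) (x : X) (r : ℝ) :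
    ENNReal.ofReal (μ.real (Metric.closedBall x r)) = μ (Metric.closedBall x r) :=
  ofReal_measureReal (hμ.measure_closedBall_ne_top x r)

theorem IsMetricMeasure.real_mono_of_subset_ball (hμ : IsMetricMeasure μ) {x : X} {r : ℝ}
    {F : Set X} (h : F ⊆ Metric.ball x r) : μ.real F ≤ μ.real (Metric.ball x r) :=
  measureReal_mono h (hμ.measure_ball_ne_top x r)

theorem measure_ball_le_of_forall_lt (x : X) {t : ℝ} {c : ℝ≥0∞}
    (h : ∀ r < t, μ (Metric.ball x r) ≤ c) : μ (Metric.ball x t) ≤ c := by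
  obtain ⟨r, hr_mono, hr_lt, hr_lim⟩ := exists_seq_strictMono_tendsto t
  have hunion : Metric.ball x t = ⋃ n, Metric.ball x (r n) := by
    refine Subset.antisymm (fun y hy => ?_)
      (iUnion_subset fun n => Metric.ball_subset_ball (hr_lt n).le)
    exact mem_iUnion.mpr (hr_lim.eventually_const_lt hy).exists
  have hmono : Monotone fun n => Metric.ball x (r n) := fun m n hmn =>
    Metric.ball_subset_ball (hr_mono.monotone hmn)
  rw [hunion, hmono.measure_iUnion]
  exact iSup_le fun n => h _ (hr_lt n)

variable [BorelSpace X]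

theorem le_measure_closedBall_of_forall_gt (hμ : IsMetricMeasure μ) (x : X) {t : ℝ} {c : ℝ≥0∞}
    (h : ∀ r > t, c ≤ μ (Metric.ball x r)) : c ≤ μ (Metric.closedBall x t) := by
  rw [← Metric.biInter_gt_ball]
  refine ge_of_tendsto (tendsto_measure_biInter_gt
    (fun r _ => Metric.isOpen_ball.measurableSet.nullMeasurableSet)
    (fun _ _ _ hij => Metric.ball_subset_ball hij)
    ⟨t + 1, lt_add_one t, hμ.measure_ball_ne_top x _⟩) ?_
  filter_upwards [self_mem_nhdsWithin] with r hr using h r hr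

theorem exists_radius_half (hμ : IsMetricMeasure μ) (x : X) {t : ℝ} (ht : 0 < t) :
    ∃ t', 0 ≤ t' ∧ t' < t ∧ μ (Metric.ball x t') ≤ μ (Metric.ball x t) / 2 ∧
      μ (Metric.ball x t) / 2 ≤ μ (Metric.closedBall x t') := by
  set S := {r : ℝ | μ (Metric.ball x r) ≤ μ (Metric.ball x t) / 2}
  have hlt : ∀ r ∈ S, r < t := by
    intro r (hr : μ (Metric.ball x r) ≤ μ (Metric.ball x t) / 2)
    by_contra! htr
    exact (ENNReal.half_lt_self (hμ x t ht).1.ne' (hμ x t ht).2.ne).not_ge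
      ((measure_mono (Metric.ball_subset_ball htr)).trans hr)
  have hzero : (0 : ℝ) ∈ S := by simp [S]
  have hbdd : BddAbove S := ⟨t, fun r hr => (hlt r hr).le⟩
  have hmem : sSup S ∈ S := measure_ball_le_of_forall_lt x fun r hr => by
    obtain ⟨r', hr', hrr'⟩ := exists_lt_of_lt_csSup ⟨0, hzero⟩ hr
    exact (measure_mono (Metric.ball_subset_ball hrr'.le)).trans hr'
  refine ⟨sSup S, le_csSup hbdd hzero, hlt _ hmem, hmem,
    le_measure_closedBall_of_forall_gt hμ x fun r hr => ?_⟩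
  by_contra! h
  exact hr.not_ge (le_csSup hbdd h.le)

theorem exists_real_radius_half (hμ : IsMetricMeasure μ) (x : X) {t : ℝ} (ht : 0 < t) :
    ∃ t', 0 ≤ t' ∧ t' < t ∧ μ.real (Metric.ball x t') ≤ μ.real (Metric.ball x t) / 2 ∧
      μ.real (Metric.ball x t) ≤ 2 * μ.real (Metric.closedBall x t') := by
  obtain ⟨t', ht'₀, ht't, hhalf, hhalf'⟩ := exists_radius_half hμ x ht
  refine ⟨t', ht'₀, ht't, ?_, ?_⟩
  · simpa [measureReal_def] using ENNReal.toReal_mono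
      (ENNReal.div_ne_top (hμ.measure_ball_ne_top x t) two_ne_zero) hhalf
  · have h := ENNReal.toReal_mono (hμ.measure_closedBall_ne_top x t') hhalf'
    rw [ENNReal.toReal_div, ENNReal.toReal_ofNat, div_le_iff₀ two_pos] at h
    rwa [mul_comm]

theorem inv_one_sub_two_rpow_neg_pos {b : ℝ} (hb : 0 < b) : 0 < (1 - (2 : ℝ) ^ (-b))⁻¹ :=
  inv_pos.mpr (sub_pos.mpr
    (Real.rpow_lt_one_of_one_lt_of_neg one_lt_two (neg_lt_zero.mpr hb)))

/-- One halving of the measure does not decrease `t - C * μ (B(z,t)) ^ b`: the gap between the two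
radii is paid for by the geometric series that defines `C`. -/
theorem exists_radius_half_sub_mul_rpow_le (hμ : IsMetricMeasure μ) (z : X) {ρ K b t : ℝ}
    (hb : 0 < b) (hK : 0 < K)
    (hgap : ∀ t' t : ℝ, 0 ≤ t' → t' < t → t ≤ ρ →
      μ.real (Metric.ball z t) ≤ 2 * μ.real (Metric.closedBall z t') →
      t - t' ≤ K * μ.real (Metric.ball z t) ^ b) (ht : 0 < t) (htρ : t ≤ ρ) :
    ∃ t' ≤ ρ, μ.real (Metric.ball z t') ≤ μ.real (Metric.ball z t) / 2 ∧
      t - K * (1 - 2 ^ (-b))⁻¹ * μ.real (Metric.ball z t) ^ b ≤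
        t' - K * (1 - 2 ^ (-b))⁻¹ * μ.real (Metric.ball z t') ^ b := by
  obtain ⟨t', ht'₀, ht't, hhalf, hclosed⟩ := exists_real_radius_half hμ z ht
  refine ⟨t', ht't.le.trans htρ, hhalf, ?_⟩
  set I : ℝ := (1 - 2 ^ (-b))⁻¹
  have hI : 0 < I := inv_one_sub_two_rpow_neg_pos hb
  have hrpow : μ.real (Metric.ball z t') ^ b ≤ μ.real (Metric.ball z t) ^ b * 2 ^ (-b) := by
    rw [Real.rpow_neg zero_le_two, ← div_eq_mul_inv, ← Real.div_rpow measureReal_nonneg zero_le_two]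
    exact Real.rpow_le_rpow measureReal_nonneg hhalf hb.le
  have hgeom : K + K * I * 2 ^ (-b) = K * I := by
    linear_combination (-K) * inv_mul_cancel₀ (inv_pos.mp hI).ne'
  calc t - K * I * μ.real (Metric.ball z t) ^ b
      = t - K * μ.real (Metric.ball z t) ^ b -
          K * I * (μ.real (Metric.ball z t) ^ b * 2 ^ (-b)) := by
        linear_combination μ.real (Metric.ball z t) ^ b * hgeom
    _ ≤ t' - K * I * μ.real (Metric.ball z t') ^ b := by
        gcongr
        linarith [hgap t' t ht'₀ ht't htρ hclosed]

theorem le_mul_rpow_real_ball_of_gap_le (hμ : IsMetricMeasure μ) (z : X) {ρ K b : ℝ}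
    (hb : 0 < b) (hK : 0 < K)
    (hgap : ∀ t' t : ℝ, 0 ≤ t' → t' < t → t ≤ ρ →
      μ.real (Metric.ball z t) ≤ 2 * μ.real (Metric.closedBall z t') →
      t - t' ≤ K * μ.real (Metric.ball z t) ^ b) :
    ρ ≤ K * (1 - 2 ^ (-b))⁻¹ * μ.real (Metric.ball z ρ) ^ b := by
  by_contra! hlt
  set C : ℝ := K * (1 - 2 ^ (-b))⁻¹
  have hC : 0 < C := mul_pos hK (inv_one_sub_two_rpow_neg_pos hb)
  set e := ρ - C * μ.real (Metric.ball z ρ) ^ b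
  have he : 0 < e := sub_pos.mpr hlt
  have hle : ∀ t, e ≤ t - C * μ.real (Metric.ball z t) ^ b → e ≤ t := fun t h =>
    h.trans (sub_le_self _ (by positivity))
  have hradius : ∀ n : ℕ, ∃ t ≤ ρ, μ.real (Metric.ball z t) ≤
      μ.real (Metric.ball z ρ) * (1 / 2) ^ n ∧ e ≤ t - C * μ.real (Metric.ball z t) ^ b := by
    intro n
    induction n with
    | zero => exact ⟨ρ, le_rfl, by simp, le_rfl⟩
    | succ n ih =>
      obtain ⟨t, htρ, htn, het⟩ := ih
      obtain ⟨t', ht'ρ, hhalf, hsub⟩ := exists_radius_half_sub_mul_rpow_le hμ z hb hK hgap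
        (he.trans_le (hle t het)) htρ
      refine ⟨t', ht'ρ, hhalf.trans ?_, het.trans hsub⟩
      rw [pow_succ, ← mul_assoc, mul_one_div]
      gcongr
  have hsmall : ∀ n : ℕ, μ.real (Metric.ball z e) ≤ μ.real (Metric.ball z ρ) * (1 / 2) ^ n := by
    intro n
    obtain ⟨t, -, htn, het⟩ := hradius n
    exact (hμ.real_mono_of_subset_ball (Metric.ball_subset_ball (hle t het))).trans htn
  have hlim := (tendsto_pow_atTop_nhds_zero_of_lt_one (r := (1 / 2 : ℝ)) (by norm_num)
    (by norm_num)).const_mul (μ.real (Metric.ball z ρ))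
  rw [mul_zero] at hlim
  exact (hμ.real_ball_pos z he).not_ge (ge_of_tendsto' hlim hsmall)

/-- The constant `(1 - 2 ^ (-b/a)) ^ (-a)` that summing the gaps between halving radii costs when
the `a`-th powers of the gaps are controlled by the `b`-th power of the measure. -/
noncomputable def iterationConst (a b : ℝ) : ℝ :=
  (1 - 2 ^ (-(b / a)))⁻¹ ^ a

theorem iterationConst_pos {a b : ℝ} (ha : 0 < a) (hb : 0 < b) : 0 < iterationConst a b :=
  Real.rpow_pos_of_pos (inv_one_sub_two_rpow_neg_pos (by positivity)) a

theorem iterationConst_le_iterationConst {a a₁ b b₀ : ℝ} (ha : 0 < a) (haa₁ : a ≤ a₁)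
    (hb₀ : 0 < b₀) (hb₀b : b₀ ≤ b) : iterationConst a b ≤ iterationConst a₁ b₀ := by
  have ha₁ : 0 < a₁ := ha.trans_le haa₁
  have hb : 0 < b := hb₀.trans_le hb₀b
  have hbase : ∀ c : ℝ, 0 < c → 0 < 1 - (2 : ℝ) ^ (-c) := fun c hc =>
    inv_pos.mp (inv_one_sub_two_rpow_neg_pos hc)
  have hone : 1 ≤ (1 - (2 : ℝ) ^ (-(b₀ / a₁)))⁻¹ :=
    one_le_inv₀ (hbase _ (by positivity)) |>.mpr (sub_le_self _ (by positivity))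
  have hle : (1 - (2 : ℝ) ^ (-(b / a)))⁻¹ ≤ (1 - 2 ^ (-(b₀ / a₁)))⁻¹ := by
    have := hbase (b₀ / a₁) (by positivity)
    gcongr
    exact one_le_two
  calc iterationConst a b ≤ (1 - 2 ^ (-(b₀ / a₁)))⁻¹ ^ a :=
        Real.rpow_le_rpow (inv_one_sub_two_rpow_neg_pos (by positivity)).le hle ha.le
    _ ≤ iterationConst a₁ b₀ := Real.rpow_le_rpow_of_exponent_le hone haa₁

theorem gap_le_of_rpow_le {L v w a g β K : ℝ} (hL : 0 < L) (hv : 0 < v) (hvw : v ≤ 2 * w)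
    (ha : 0 < a) (hg : 0 ≤ g) (hK : 0 < K) (h : w ^ g ≤ K * (L ^ (-a) * v ^ β)) :
    L ≤ (K * 2 ^ g) ^ a⁻¹ * v ^ ((β - g) / a) := by
  have hw : 0 < w := by linarith
  have hpow : L ^ a ≤ K * 2 ^ g * v ^ (β - g) := by
    rw [Real.rpow_neg hL.le, ← mul_assoc, mul_comm K, mul_assoc, inv_mul_eq_div,
      le_div_iff₀ (by positivity)] at h
    rw [Real.rpow_sub hv, mul_div_assoc', le_div_iff₀ (by positivity)]
    calc L ^ a * v ^ g ≤ L ^ a * (2 * w) ^ g := by gcongr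
      _ = 2 ^ g * (w ^ g * L ^ a) := by rw [Real.mul_rpow zero_le_two hw.le]; ring
      _ ≤ 2 ^ g * (K * v ^ β) := by gcongr
      _ = K * 2 ^ g * v ^ β := by ring
  calc L = (L ^ a) ^ a⁻¹ := (Real.rpow_rpow_inv hL.le ha.ne').symm
    _ ≤ (K * 2 ^ g * v ^ (β - g)) ^ a⁻¹ := by gcongr
    _ = (K * 2 ^ g) ^ a⁻¹ * v ^ ((β - g) / a) := by
      rw [Real.mul_rpow (by positivity) (by positivity), ← Real.rpow_mul hv.le, div_eq_mul_inv]

theorem rpow_le_mul_rpow_real_ball_of_closedBall (hμ : IsMetricMeasure μ) (z : X)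
    {ρ a g β K : ℝ} (hρ : 0 < ρ) (ha : 0 < a) (hg : 0 ≤ g) (hβ : 0 < β - g) (hK : 0 < K)
    (h : ∀ t' t : ℝ, t' < t → t ≤ ρ → 0 < μ.real (Metric.closedBall z t') →
      μ.real (Metric.closedBall z t') ^ g ≤
        K * ((t - t') ^ (-a) * μ.real (Metric.ball z t) ^ β)) :
    ρ ^ a ≤ K * 2 ^ g * iterationConst a (β - g) * μ.real (Metric.ball z ρ) ^ (β - g) := by
  set b := (β - g) / a
  have hb : 0 < b := div_pos hβ ha
  have hI := inv_one_sub_two_rpow_neg_pos hb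
  have hρ_le : ρ ≤ (K * 2 ^ g) ^ a⁻¹ * (1 - 2 ^ (-b))⁻¹ * μ.real (Metric.ball z ρ) ^ b := by
    refine le_mul_rpow_real_ball_of_gap_le hμ z hb (by positivity)
      fun t' t ht'₀ ht't htρ hhalf => ?_
    have hv : 0 < μ.real (Metric.ball z t) := hμ.real_ball_pos z (ht'₀.trans_lt ht't)
    exact gap_le_of_rpow_le (sub_pos.mpr ht't) hv hhalf ha hg hK
      (h t' t ht't htρ (by linarith))
  calc ρ ^ a ≤ ((K * 2 ^ g) ^ a⁻¹ * (1 - 2 ^ (-b))⁻¹ * μ.real (Metric.ball z ρ) ^ b) ^ a := by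
        gcongr
    _ = K * 2 ^ g * iterationConst a (β - g) * μ.real (Metric.ball z ρ) ^ (β - g) := by
        rw [Real.mul_rpow (by positivity) (by positivity), Real.mul_rpow (by positivity) hI.le,
          Real.rpow_inv_rpow (by positivity) ha.ne', ← Real.rpow_mul measureReal_nonneg,
          div_mul_cancel₀ _ ha.ne', iterationConst]

end Iteration

/-! ### Criteria for lower Ahlfors regularity -/

section Criteria

variable {X : Type*} [MetricSpace X] [MeasurableSpace X] {μ : Measure X}

theorem lowerAhlforsRegular_of_forall_small (hμ : IsMetricMeasure μ) {Q : X → ℝ} {Q₁ c r₁ : ℝ}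
    (hQ : ∀ x, 0 ≤ Q x) (hQ₁ : ∀ x, Q x ≤ Q₁) (hc : 0 < c) (hr₁ : 0 < r₁) (hr₁_one : r₁ ≤ 1)
    (h : ∀ x r, 0 < r → r ≤ r₁ → c * r ^ Q x ≤ μ.real (Metric.ball x r)) :
    LowerAhlforsRegular μ Q := by
  refine ⟨c * r₁ ^ Q₁, by positivity, fun x r hr hr_one => ?_⟩
  rw [← hμ.ofReal_real_ball x r]
  refine ENNReal.ofReal_le_ofReal ?_
  have hr₁Q : r₁ ^ Q₁ ≤ r₁ ^ Q x := Real.rpow_le_rpow_of_exponent_ge hr₁ hr₁_one (hQ₁ x)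
  rcases le_total r r₁ with hle | hle
  · calc c * r₁ ^ Q₁ * r ^ Q x ≤ c * 1 * r ^ Q x := by
          gcongr
          exact hr₁Q.trans (Real.rpow_le_one hr₁.le hr₁_one (hQ x))
      _ = c * r ^ Q x := by rw [mul_one]
      _ ≤ μ.real (Metric.ball x r) := h x r hr hle
  · calc c * r₁ ^ Q₁ * r ^ Q x ≤ c * r₁ ^ Q x * 1 := by
          gcongr
          exact Real.rpow_le_one hr.le hr_one (hQ x)
      _ = c * r₁ ^ Q x := mul_one _
      _ ≤ μ.real (Metric.ball x r₁) := h x r₁ hr₁ le_rfl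
      _ ≤ μ.real (Metric.ball x r) := hμ.real_mono_of_subset_ball (Metric.ball_subset_ball hle)

/-- If `d * l` is bounded, so is `d * m`, because `m` is at most a multiple of `l` plus a constant;
hence the errors `d` in the two exponents only cost a constant. -/
theorem mul_le_add_of_sub_mul_le_add {B S S₁ d κ m l A C : ℝ} (hκ : 0 < κ) (hκB : κ ≤ B)
    (hS₁ : 0 ≤ S₁) (hS : S ≤ S₁) (hd : 0 ≤ d) (hdκ : d ≤ κ / 4) (hm : 0 ≤ m) (hl : 0 ≤ l)
    (hA : 0 ≤ A) (hC : 0 ≤ C) (hdl : d * l ≤ C) (h : (B - 2 * d) * m ≤ A + (S + d) * l) :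
    B * m ≤ 2 * (A + C) + 4 / κ * (S₁ * C) + S * l := by
  have hm_le : κ / 2 * m ≤ A + S₁ * l + C := by
    calc κ / 2 * m ≤ (B - 2 * d) * m := by gcongr; linarith
      _ ≤ A + (S + d) * l := h
      _ = A + S * l + d * l := by ring
      _ ≤ A + S₁ * l + C := by gcongr
  have hdm : d * m ≤ 2 / κ * (κ / 4 * (A + C) + S₁ * C) := by
    rw [div_mul_eq_mul_div, le_div_iff₀ hκ]
    calc d * m * κ = 2 * (d * (κ / 2 * m)) := by ring
      _ ≤ 2 * (d * (A + S₁ * l + C)) := by gcongr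
      _ = 2 * (d * (A + C) + S₁ * (d * l)) := by ring
      _ ≤ 2 * (κ / 4 * (A + C) + S₁ * C) := by gcongr
  have hexpand : 2 / κ * (κ / 4 * (A + C) + S₁ * C) = (A + C) / 2 + 2 / κ * (S₁ * C) := by
    field_simp
    ring
  rw [hexpand] at hdm
  linarith [show 4 / κ * (S₁ * C) = 2 * (2 / κ * (S₁ * C)) by ring]

theorem rpow_le_mul_of_rpow_add_le_mul_rpow_sub {B S S₁ d κ D C r v : ℝ} (hκ : 0 < κ)
    (hκB : κ ≤ B) (hS₁ : 0 ≤ S₁) (hS : S ≤ S₁) (hd : 0 ≤ d) (hdκ : d ≤ κ / 4) (hD : 1 ≤ D)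
    (hC : 0 ≤ C) (hr : 0 < r) (hr_one : r ≤ 1) (hv : 0 < v) (hv_one : v ≤ 1)
    (hdl : d * Real.log (1 / r) ≤ C) (h : r ^ (S + d) ≤ D * v ^ (B - 2 * d)) :
    Real.exp (-((2 * (Real.log D + C) + 4 / κ * (S₁ * C)) / κ)) * r ^ (S / B) ≤ v := by
  have hB : 0 < B := hκ.trans_le hκB
  have hlog : (B - 2 * d) * Real.log (1 / v) ≤ Real.log D + (S + d) * Real.log (1 / r) := by
    have := Real.log_le_log (by positivity) h
    rw [Real.log_rpow hr, Real.log_mul (by positivity) (by positivity), Real.log_rpow hv] at this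
    rw [one_div, one_div, Real.log_inv, Real.log_inv]
    linarith
  have hE : 0 ≤ 2 * (Real.log D + C) + 4 / κ * (S₁ * C) := by
    have := Real.log_nonneg hD
    positivity
  have hlogv := mul_le_add_of_sub_mul_le_add hκ hκB hS₁ hS hd hdκ
    (Real.log_nonneg (one_le_one_div hv hv_one)) (Real.log_nonneg (one_le_one_div hr hr_one))
    (Real.log_nonneg hD) hC hdl hlog
  set E := 2 * (Real.log D + C) + 4 / κ * (S₁ * C)
  rw [one_div, one_div, Real.log_inv, Real.log_inv] at hlogv
  rw [Real.rpow_def_of_pos hr, ← Real.exp_add, ← Real.le_log_iff_exp_le hv]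
  calc -(E / κ) + Real.log r * (S / B) ≤ -(E / B) + Real.log r * (S / B) := by gcongr
    _ = (-E + Real.log r * S) / B := by ring
    _ ≤ Real.log v := by
      rw [div_le_iff₀ hB]
      linarith

/-- The logarithmic error terms that come from freezing log-Hölder continuous functions `f i` at
the centre of a ball do not affect lower Ahlfors regularity. -/
theorem lowerAhlforsRegular_of_forall_oscillation {ι : Type*} [Finite ι] {f : ι → X → ℝ}
    (hf : ∀ i, LogHolder (f i)) (hμ : IsMetricMeasure μ) {S B : X → ℝ} {S₁ κ D v₀ r₀ : ℝ}
    (hS₀ : ∀ x, 0 ≤ S x) (hS : ∀ x, S x ≤ S₁) (hκ : 0 < κ) (hκB : ∀ x, κ ≤ B x) (hv₀ : 0 < v₀)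
    (hr₀ : 0 < r₀)
    (h : ∀ x r d, 0 < r → r ≤ r₀ → 0 ≤ d → d ≤ κ / 4 →
      (∀ i y, dist x y < r → |f i x - f i y| ≤ d) → μ.real (Metric.ball x r) ≤ v₀ →
      μ.real (Metric.ball x r) ≤ r ^ (S x / B x) →
      r ^ (S x + d) ≤ D * μ.real (Metric.ball x r) ^ (B x - 2 * d)) :
    LowerAhlforsRegular μ fun x => S x / B x := by
  rcases isEmpty_or_nonempty X with _ | ⟨⟨x₀⟩⟩
  · exact ⟨1, one_pos, fun x => isEmptyElim x⟩
  have hS₁ : 0 ≤ S₁ := (hS₀ x₀).trans (hS x₀)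
  have hB : ∀ x, 0 < B x := fun x => hκ.trans_le (hκB x)
  obtain ⟨C, r₁, hr₁, hr₁_one, hosc⟩ := exists_forall_oscillation_le hf (by positivity : 0 < κ / 4)
  set E : ℝ := (2 * (Real.log (max D 1) + max C 0) + 4 / κ * (S₁ * max C 0)) / κ
  refine lowerAhlforsRegular_of_forall_small (Q₁ := S₁ / κ)
    (c := min (Real.exp (-E)) (min v₀ 1)) (r₁ := min r₀ r₁) hμ
    (fun x => div_nonneg (hS₀ x) (hB x).le)
    (fun x => div_le_div₀ hS₁ (hS x) hκ (hκB x)) (by positivity) (lt_min hr₀ hr₁)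
    ((min_le_right _ _).trans hr₁_one.le) fun x r hr hr_le => ?_
  obtain ⟨d, hd, hdκ, hdl, hfd⟩ := hosc r hr (hr_le.trans (min_le_right _ _))
  have hr_one : r ≤ 1 := hr_le.trans ((min_le_right _ _).trans hr₁_one.le)
  have hQ_one : r ^ (S x / B x) ≤ 1 :=
    Real.rpow_le_one hr.le hr_one (div_nonneg (hS₀ x) (hB x).le)
  have hc_exp := min_le_left (Real.exp (-E)) (min v₀ 1)
  have hc_min := min_le_right (Real.exp (-E)) (min v₀ 1)
  set v := μ.real (Metric.ball x r)
  set c := min (Real.exp (-E)) (min v₀ 1)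
  rcases le_total (r ^ (S x / B x)) v with hv | hv
  · refine (mul_le_of_le_one_left (by positivity) (hc_min.trans (min_le_right _ _))).trans hv
  rcases le_total v₀ v with hv' | hv'
  · exact (mul_le_of_le_one_right (by positivity) hQ_one).trans
      ((hc_min.trans (min_le_left _ _)).trans hv')
  have hmain : r ^ (S x + d) ≤ max D 1 * v ^ (B x - 2 * d) :=
    (h x r d hr (hr_le.trans (min_le_left _ _)) hd hdκ (fun i y => hfd i x y) hv' hv).trans
      (by gcongr; exact le_max_left _ _)
  calc c * r ^ (S x / B x) ≤ Real.exp (-E) * r ^ (S x / B x) := by gcongr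
    _ ≤ v := rpow_le_mul_of_rpow_add_le_mul_rpow_sub hκ (hκB x) hS₁ (hS x) hd hdκ
      (le_max_right _ _) (le_max_right _ _) hr hr_one (hμ.real_ball_pos x hr) (hv.trans hQ_one)
      (hdl.trans (le_max_left _ _)) hmain

theorem rpow_le_mul_rpow_real_ball_of_le [BorelSpace X] (hμ : IsMetricMeasure μ) (z : X)
    {ρ a a₁ g G b b₀ K : ℝ} (hρ : 0 < ρ) (ha : 0 < a) (haa₁ : a ≤ a₁) (hg : 0 ≤ g) (hgG : g ≤ G)
    (hb₀ : 0 < b₀) (hb₀b : b₀ ≤ b) (hK : 0 < K)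
    (h : ∀ t' t, t' < t → t ≤ ρ → 0 < μ.real (Metric.closedBall z t') →
      μ.real (Metric.closedBall z t') ^ g ≤
        K * ((t - t') ^ (-a) * μ.real (Metric.ball z t) ^ (b + g))) :
    ρ ^ a ≤ K * 2 ^ G * iterationConst a₁ b₀ * μ.real (Metric.ball z ρ) ^ b := by
  have hb : 0 < b := hb₀.trans_le hb₀b
  have hiter := rpow_le_mul_rpow_real_ball_of_closedBall hμ z hρ ha hg (by linarith) hK h
  rw [add_sub_cancel_right] at hiter
  have hI := iterationConst_pos ha hb
  refine hiter.trans ?_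
  gcongr
  · exact one_le_two
  · exact iterationConst_le_iterationConst ha haa₁ hb₀ hb₀b

/-- Iterating an estimate for pairs of concentric balls in `B(x,r)` over radii that halve the
measure gives the lower bound for `μ (B(x,r))`. -/
theorem lowerAhlforsRegular_of_forall_closedBall [BorelSpace X] {ι : Type*} [Finite ι]
    {f : ι → X → ℝ} (hf : ∀ i, LogHolder (f i)) (hμ : IsMetricMeasure μ) {S B : X → ℝ}
    {S₁ G κ θ K v₀ r₀ : ℝ} (hS₀ : ∀ x, 0 < S x) (hS : ∀ x, S x ≤ S₁) (hκ : 0 < κ)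
    (hκB : ∀ x, κ ≤ B x) (hθ : 0 < θ) (hθ_one : θ ≤ 1) (hK : 0 < K) (hv₀ : 0 < v₀) (hr₀ : 0 < r₀)
    (h : ∀ x r d, 0 < r → r ≤ r₀ → 0 ≤ d → d ≤ κ / 4 →
      (∀ i y, dist x y < r → |f i x - f i y| ≤ d) → μ.real (Metric.ball x r) ≤ v₀ →
      μ.real (Metric.ball x r) ≤ r ^ (S x / B x) →
      ∃ z g e, Metric.ball z (θ * r) ⊆ Metric.ball x r ∧ 0 ≤ g ∧ g ≤ G ∧ e ≤ κ / 4 ∧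
        ∀ t' t, t' < t → t ≤ θ * r → 0 < μ.real (Metric.closedBall z t') →
          μ.real (Metric.closedBall z t') ^ g ≤ K * μ.real (Metric.ball x r) ^ e *
            ((t - t') ^ (-(S x + d)) * μ.real (Metric.ball z t) ^ (B x - 2 * d - e + g))) :
    LowerAhlforsRegular μ fun x => S x / B x := by
  set I := iterationConst (S₁ + κ / 4) (κ / 4)
  refine lowerAhlforsRegular_of_forall_oscillation (f := f) (S₁ := S₁) (κ := κ) (v₀ := v₀)
    (r₀ := r₀) (D := (θ ^ (S₁ + κ / 4))⁻¹ * (K * 2 ^ G * I)) hf hμ (fun x => (hS₀ x).le) hS hκ hκB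
    hv₀ hr₀ fun x r d hr hr_le hd hdκ hfd hv hvr => ?_
  obtain ⟨z, g, e, hzx, hg, hgG, heκ, hest⟩ := h x r d hr hr_le hd hdκ hfd hv hvr
  have hSx := hS₀ x
  have hSx₁ := hS x
  have hBx := hκB x
  have hI : 0 < I := iterationConst_pos (by linarith) (by linarith)
  have hv_pos := hμ.real_ball_pos x hr
  set v := μ.real (Metric.ball x r)
  rw [mul_assoc, inv_mul_eq_div, le_div_iff₀ (by positivity), mul_comm]
  calc θ ^ (S₁ + κ / 4) * r ^ (S x + d) ≤ θ ^ (S x + d) * r ^ (S x + d) := by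
        gcongr ?_ * _
        exact Real.rpow_le_rpow_of_exponent_ge hθ hθ_one (by linarith)
    _ = (θ * r) ^ (S x + d) := (Real.mul_rpow hθ.le hr.le).symm
    _ ≤ K * v ^ e * 2 ^ G * I * μ.real (Metric.ball z (θ * r)) ^ (B x - 2 * d - e) :=
        rpow_le_mul_rpow_real_ball_of_le hμ z (by positivity) (by linarith) (by linarith) hg hgG
          (by linarith) (by linarith) (by positivity) hest
    _ ≤ K * v ^ e * 2 ^ G * I * v ^ (B x - 2 * d - e) := by
        gcongr ?_ * ?_
        exact Real.rpow_le_rpow measureReal_nonneg (hμ.real_mono_of_subset_ball hzx) (by linarith)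
    _ = K * 2 ^ G * I * v ^ (B x - 2 * d) := by
        rw [Real.rpow_sub hv_pos]
        field_simp

theorem lowerAhlforsRegular_of_subsingleton [Subsingleton X] (hμ : IsMetricMeasure μ)
    {Q : X → ℝ} (hQ : ∀ x, 0 ≤ Q x) : LowerAhlforsRegular μ Q := by
  rcases isEmpty_or_nonempty X with _ | ⟨⟨x₀⟩⟩
  · exact ⟨1, one_pos, fun x => isEmptyElim x⟩
  refine ⟨μ.real (Metric.ball x₀ 1), hμ.real_ball_pos x₀ one_pos, fun x r hr hr_one => ?_⟩
  have hball : Metric.ball x r = Metric.ball x₀ 1 := by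
    ext y
    simp [Subsingleton.elim y x, Subsingleton.elim x₀ x, hr]
  rw [hball, ← hμ.ofReal_real_ball]
  exact ENNReal.ofReal_le_ofReal
    (mul_le_of_le_one_right measureReal_nonneg (Real.rpow_le_one hr.le hr_one (hQ x)))

theorem lebesgueNorm_bumpProfile_le_of_oscillation [BorelSpace X] (hμ : IsMetricMeasure μ)
    {s p : X → ℝ} (hp : ∀ x, 0 < p x) {x z : X} {r d a b : ℝ} (hab : a < b) (hba : b - a ≤ 1)
    (hb : 0 < b) (hzb : Metric.ball z b ⊆ Metric.ball x r)
    (hsd : ∀ y, dist x y < r → |s x - s y| ≤ d)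
    (hpd : ∀ y, dist x y < r → |1 / p x - 1 / p y| ≤ d) (hv : μ.real (Metric.ball z b) ≤ 1) :
    lebesgueNorm μ p (bumpProfile s z a b) ≤ ENNReal.ofReal
      ((b - a) ^ (-(s x + d)) * μ.real (Metric.ball z b) ^ (1 / p x - d)) := by
  have hv₀ := hμ.real_ball_pos z hb
  have hdist : ∀ y ∈ Metric.ball z b, dist x y < r := fun y hy => Metric.mem_ball'.mp (hzb hy)
  refine lebesgueNorm_bumpProfile_le hp hab hba
    (fun y hy => by linarith [(abs_le.mp (hsd y (hdist y hy))).1]) (by positivity) fun y hy => ?_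
  rw [← hμ.ofReal_real_ball, ← Real.rpow_mul hv₀.le]
  refine ENNReal.ofReal_le_ofReal ?_
  have hexp : (1 / p x - d) * p y ≤ 1 := by
    rw [← le_div_iff₀ (hp y)]
    linarith [(abs_le.mp (hpd y (hdist y hy))).2]
  simpa only [Real.rpow_one] using Real.rpow_le_rpow_of_exponent_ge hv₀ hv hexp

end Criteria

/-! ### Distance of a bump to the constants -/

section Oscillation

variable {X : Type*} {u : X → ℝ} {F₁ F₂ : Set X}

theorem half_le_abs_sub_or_half_le_abs_sub (hu₁ : ∀ x ∈ F₁, u x = 1) (hu₂ : ∀ x ∈ F₂, u x = 0)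
    (c : ℝ) : (∀ x ∈ F₁, 1 / 2 ≤ |u x - c|) ∨ ∀ x ∈ F₂, 1 / 2 ≤ |u x - c| := by
  rcases le_total c (1 / 2) with hc | hc
  · refine Or.inl fun x hx => ?_
    rw [hu₁ x hx]
    exact (by linarith : 1 / 2 ≤ 1 - c).trans (le_abs_self _)
  · refine Or.inr fun x hx => ?_
    rwa [hu₂ x hx, zero_sub, abs_neg, abs_of_nonneg (by linarith)]

variable [MeasurableSpace X] {ν : Measure X}

theorem half_mul_min_rpow_le_iInf_lebesgueNorm_sub {γ : X → ℝ} {G₁ G₂ : ℝ} {m₁ m₂ : ℝ≥0∞}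
    (hF₁ : MeasurableSet F₁) (hF₂ : MeasurableSet F₂)
    (hu₁ : ∀ x ∈ F₁, u x = 1) (hu₂ : ∀ x ∈ F₂, u x = 0) (hG₁ : 0 < G₁) (hG₂ : 0 < G₂)
    (hγ₁ : ∀ x ∈ F₁, G₁⁻¹ ≤ γ x) (hγ₂ : ∀ x ∈ F₂, G₂⁻¹ ≤ γ x)
    (hm₁ : m₁ ≤ ν F₁) (hm₂ : m₂ ≤ ν F₂) (hm₁_one : m₁ ≤ 1) (hm₂_one : m₂ ≤ 1) :
    ENNReal.ofReal (1 / 2) * min (m₁ ^ G₁) (m₂ ^ G₂) ≤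
      ⨅ c : ℝ, lebesgueNorm ν γ fun x => ENNReal.ofReal |u x - c| := by
  refine le_iInf fun c => ?_
  rcases half_le_abs_sub_or_half_le_abs_sub hu₁ hu₂ c with h | h
  · exact (mul_le_mul_right (min_le_left _ _) _).trans (mul_rpow_le_lebesgueNorm hF₁ hG₁ hγ₁
      (fun x hx => ENNReal.ofReal_le_ofReal (h x hx)) hm₁ hm₁_one)
  · exact (mul_le_mul_right (min_le_right _ _) _).trans (mul_rpow_le_lebesgueNorm hF₂ hG₂ hγ₂
      (fun x hx => ENNReal.ofReal_le_ofReal (h x hx)) hm₂ hm₂_one)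

theorem ofReal_div_mul_exp_le_expAverage {B F : Set X} {f : X → ℝ} {ω ξ w v : ℝ}
    (hF : MeasurableSet F) (hFB : F ⊆ B) (hω : 0 ≤ ω) (hξ : 0 ≤ ξ) (hf : ∀ x ∈ F, ξ ≤ f x)
    (hw : ENNReal.ofReal w ≤ ν F) (hv : 0 < v) (hB : ν B = ENNReal.ofReal v) :
    ENNReal.ofReal (w / v * Real.exp (ξ ^ ω)) ≤ expAverage ν B ω f := by
  rw [div_mul_eq_mul_div, ENNReal.ofReal_div_of_pos hv, expAverage, hB, mul_comm,
    ENNReal.ofReal_mul (Real.exp_pos _).le]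
  gcongr
  calc ENNReal.ofReal (Real.exp (ξ ^ ω)) * ENNReal.ofReal w
      ≤ ∫⁻ _ in F, ENNReal.ofReal (Real.exp (ξ ^ ω)) ∂ν := by
        rw [setLIntegral_const]
        gcongr
    _ ≤ ∫⁻ x in F, ENNReal.ofReal (Real.exp (f x ^ ω)) ∂ν :=
        setLIntegral_mono' hF fun x hx => ENNReal.ofReal_le_ofReal
          (Real.exp_le_exp.mpr (Real.rpow_le_rpow hξ (hf x hx) hω))
    _ ≤ ∫⁻ x in B, ENNReal.ofReal (Real.exp (f x ^ ω)) ∂ν := lintegral_mono_set hFB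

theorem ofReal_div_mul_exp_le_iInf_expAverage_sub {B : Set X} {C N ω w v : ℝ}
    (hF₁ : MeasurableSet F₁) (hF₂ : MeasurableSet F₂) (hF₁B : F₁ ⊆ B) (hF₂B : F₂ ⊆ B)
    (hu₁ : ∀ x ∈ F₁, u x = 1) (hu₂ : ∀ x ∈ F₂, u x = 0) (hC : 0 ≤ C) (hN : 0 ≤ N) (hω : 0 ≤ ω)
    (hw₁ : ENNReal.ofReal w ≤ ν F₁) (hw₂ : ENNReal.ofReal w ≤ ν F₂) (hv : 0 < v)
    (hB : ν B = ENNReal.ofReal v) :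
    ENNReal.ofReal (w / v * Real.exp ((C * (1 / 2 / N)) ^ ω)) ≤
      ⨅ c : ℝ, expAverage ν B ω fun x => C * (|u x - c| / N) := by
  have hξ : 0 ≤ C * (1 / 2 / N) := by positivity
  refine le_iInf fun c => ?_
  rcases half_le_abs_sub_or_half_le_abs_sub hu₁ hu₂ c with h | h
  · exact ofReal_div_mul_exp_le_expAverage hF₁ hF₁B hω hξ
      (fun x hx => by have := h x hx; gcongr) hw₁ hv hB
  · exact ofReal_div_mul_exp_le_expAverage hF₂ hF₂B hω hξ
      (fun x hx => by have := h x hx; gcongr) hw₂ hv hB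

end Oscillation

/-! ### Functions of vanishing homogeneous quasi-norm -/

section Vanishing

theorem ae_tendsto_zero_of_tsum_lebesgueModular_ne_top {X : Type*} [MeasurableSpace X]
    {ν : Measure X} {p : X → ℝ} {f : ℕ → X → ℝ≥0∞}
    (hp_meas : Measurable p) (hp : ∀ x, 0 < p x) (hf : ∀ n, Measurable (f n))
    (h : ∑' n, lebesgueModular ν p (f n) ≠ ∞) :
    ∀ᵐ x ∂ν, Filter.Tendsto (fun n => f n x) Filter.atTop (nhds 0) := by
  have hmeas : ∀ n, Measurable fun x => f n x ^ p x := fun n => (hf n).pow hp_meas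
  have hfin : ∫⁻ x, ∑' n, f n x ^ p x ∂ν ≠ ∞ := by
    rwa [lintegral_tsum fun n => (hmeas n).aemeasurable]
  filter_upwards [ae_lt_top' (Measurable.tsum hmeas).aemeasurable hfin] with x hx
  have hpow := ENNReal.tendsto_atTop_zero_of_tsum_ne_top hx.ne
  have hroot := (ENNReal.continuous_rpow_const (y := (p x)⁻¹)).tendsto 0 |>.comp hpow
  rw [ENNReal.zero_rpow_of_pos (inv_pos.mpr (hp x))] at hroot
  refine hroot.congr fun n => ?_
  rw [Function.comp_apply, ENNReal.rpow_rpow_inv (hp x).ne']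

theorem eq_of_forall_isVectorGradient_of_tendsto_zero {X : Type*} [MetricSpace X]
    {s u : X → ℝ} {E : Set X} {g : ℕ → ℤ → X → ℝ≥0∞} {N : ℕ → Set X}
    (hg : ∀ n, ∀ k : ℤ, ∀ x ∈ E \ N n, ∀ y ∈ E \ N n,
      (2 : ℝ) ^ (-k - 1) ≤ dist x y → dist x y < (2 : ℝ) ^ (-k) → ENNReal.ofReal |u x - u y| ≤
        ENNReal.ofReal (dist x y ^ s x) * g n k x + ENNReal.ofReal (dist x y ^ s y) * g n k y)
    {x y : X} (hx : ∀ n, x ∈ E \ N n) (hy : ∀ n, y ∈ E \ N n)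
    (hgx : ∀ k, Filter.Tendsto (fun n => g n k x) Filter.atTop (nhds 0))
    (hgy : ∀ k, Filter.Tendsto (fun n => g n k y) Filter.atTop (nhds 0)) : u x = u y := by
  rcases eq_or_ne x y with rfl | hne
  · rfl
  obtain ⟨n, hn, hn'⟩ := exists_mem_Ico_zpow (dist_pos.mpr hne) (one_lt_two (α := ℝ))
  have hle : ∀ i, ENNReal.ofReal |u x - u y| ≤ ENNReal.ofReal (dist x y ^ s x) * g i (-n - 1) x +
      ENNReal.ofReal (dist x y ^ s y) * g i (-n - 1) y := fun i =>
    hg i (-n - 1) x (hx i) y (hy i) (by rwa [show -(-n - 1) - 1 = n by ring])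
      (by rwa [show -(-n - 1) = n + 1 by ring])
  have hlim := (ENNReal.Tendsto.const_mul (hgx (-n - 1))
    (Or.inr (ENNReal.ofReal_ne_top (r := dist x y ^ s x)))).add
    (ENNReal.Tendsto.const_mul (hgy (-n - 1))
      (Or.inr (ENNReal.ofReal_ne_top (r := dist x y ^ s y))))
  have hzero := ge_of_tendsto' hlim hle
  rw [mul_zero, mul_zero, add_zero, nonpos_iff_eq_zero, ENNReal.ofReal_eq_zero] at hzero
  exact sub_eq_zero.mp (abs_nonpos_iff.mp hzero)

variable {X : Type*} [MetricSpace X] [MeasurableSpace X] {μ : Measure X}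
  {s p : X → ℝ} {q : X → ℝ≥0∞} {A : HajlaszScale} {E : Set X} {u : X → ℝ} {p₀ q₀ : ℝ}

theorem exists_isVectorGradient_lebesgueModular_le (hp₀ : 0 < p₀) (hp : ∀ x, p₀ ≤ p x)
    (hq₀ : 0 < q₀) (hq : ∀ᵐ x ∂μ, ENNReal.ofReal q₀ ≤ q x) (h : homNorm A μ s p q E u = 0)
    {δ : ℝ≥0∞} (hδ₀ : 0 < δ) (hδ : δ ≤ 1) :
    ∃ g, IsVectorGradient μ s E u g ∧ ∀ k, lebesgueModular (μ.restrict E) p (g k) ≤ δ := by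
  have hθ : 0 < δ ^ p₀⁻¹ := ENNReal.rpow_pos hδ₀ (ne_top_of_le_ne_top ENNReal.one_ne_top hδ)
  obtain ⟨g, hg, hlt⟩ : ∃ g, ∃ _ : IsVectorGradient μ s E u g,
      gradientNorm A (μ.restrict E) p q g < δ ^ p₀⁻¹ := by
    rw [← h] at hθ
    simpa only [homNorm, iInf_lt_iff] using hθ
  refine ⟨g, hg, fun k => ?_⟩
  calc lebesgueModular (μ.restrict E) p (g k) ≤ (δ ^ p₀⁻¹) ^ p₀ :=
        lebesgueModular_le_rpow_of_lebesgueNorm_lt hp₀ hp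
          (ENNReal.rpow_le_one hδ (inv_nonneg.mpr hp₀.le))
          ((lebesgueNorm_le_gradientNorm A (fun x => hp₀.le.trans (hp x)) hq₀
            (ae_restrict_of_ae hq) g k).trans_lt hlt)
    _ = δ := ENNReal.rpow_inv_rpow hp₀.ne' δ

theorem exists_null_forall_eq_of_homNorm_eq_zero (hp_meas : Measurable p) (hp₀ : 0 < p₀)
    (hp : ∀ x, p₀ ≤ p x) (hq₀ : 0 < q₀) (hq : ∀ᵐ x ∂μ, ENNReal.ofReal q₀ ≤ q x)
    (hE : MeasurableSet E) (h : homNorm A μ s p q E u = 0) :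
    ∃ N, μ N = 0 ∧ ∀ x ∈ E \ N, ∀ y ∈ E \ N, u x = u y := by
  choose g hg hmod using fun n : ℕ => exists_isVectorGradient_lebesgueModular_le hp₀ hp hq₀ hq h
    (δ := 2⁻¹ ^ n) (ENNReal.pow_pos (by simp) n) (pow_le_one₀ zero_le (by simp))
  choose N hN hgN using fun n => (hg n).2
  have hlim : ∀ᵐ x ∂μ, x ∈ E → ∀ k, Filter.Tendsto (fun n => g n k x) Filter.atTop (nhds 0) := by
    rw [← ae_restrict_iff' hE, ae_all_iff]
    refine fun k => ae_tendsto_zero_of_tsum_lebesgueModular_ne_top hp_meas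
      (fun x => hp₀.trans_le (hp x)) (fun n => (hg n).1 k)
      (ne_top_of_le_ne_top ?_ (ENNReal.tsum_le_tsum fun n => hmod n k))
    simp [ENNReal.tsum_geometric]
  refine ⟨(⋃ n, N n) ∪ {x | ¬(x ∈ E →
    ∀ k, Filter.Tendsto (fun n => g n k x) Filter.atTop (nhds 0))},
    measure_union_null (measure_iUnion_null hN) hlim, ?_⟩
  rintro x ⟨hxE, hx⟩ y ⟨hyE, hy⟩
  simp only [mem_union, mem_iUnion, mem_ofPred_eq, not_or, not_exists, not_not] at hx hy
  exact eq_of_forall_isVectorGradient_of_tendsto_zero hgN (fun n => ⟨hxE, hx.1 n⟩)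
    (fun n => ⟨hyE, hy.1 n⟩) (hx.2 hxE) (hy.2 hyE)

theorem homNorm_pos_of_forall_ne {F₁ F₂ : Set X} (hp_meas : Measurable p) (hp₀ : 0 < p₀)
    (hp : ∀ x, p₀ ≤ p x) (hq₀ : 0 < q₀) (hq : ∀ᵐ x ∂μ, ENNReal.ofReal q₀ ≤ q x)
    (hE : MeasurableSet E) (hF₁E : F₁ ⊆ E) (hF₂E : F₂ ⊆ E) (hF₁ : 0 < μ F₁) (hF₂ : 0 < μ F₂)
    (hu : ∀ x ∈ F₁, ∀ y ∈ F₂, u x ≠ u y) : 0 < homNorm A μ s p q E u := by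
  refine pos_iff_ne_zero.mpr fun h => ?_
  obtain ⟨N, hN, huN⟩ := exists_null_forall_eq_of_homNorm_eq_zero hp_meas hp₀ hp hq₀ hq hE h
  have hnonempty : ∀ F : Set X, 0 < μ F → (F \ N).Nonempty := fun F hF =>
    nonempty_of_measure_ne_zero (by rw [measure_sdiff_null hN]; exact hF.ne')
  obtain ⟨x, hx, hxN⟩ := hnonempty F₁ hF₁
  obtain ⟨y, hy, hyN⟩ := hnonempty F₂ hF₂
  exact hu x hx y hy (huN x ⟨hF₁E hx, hxN⟩ y ⟨hF₂E hy, hyN⟩)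

end Vanishing

/-! ### Balls in metric measure spaces -/

section Balls

variable {X : Type*} [MetricSpace X]

theorem exists_forall_compl_ball_nonempty [Nontrivial X] :
    ∃ r₀ : ℝ, 0 < r₀ ∧ ∀ (x : X) (r : ℝ), r ≤ r₀ → ((Metric.ball x r)ᶜ).Nonempty := by
  obtain ⟨a, b, hab⟩ := exists_pair_ne X
  refine ⟨dist a b / 2, half_pos (dist_pos.mpr hab), fun x r hr => ?_⟩
  by_contra hne
  rw [not_nonempty_iff_eq_empty, compl_empty_iff] at hne
  have ha : dist a x < r := by rw [← Metric.mem_ball, hne]; trivial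
  have hb : dist b x < r := by rw [← Metric.mem_ball, hne]; trivial
  linarith [dist_triangle_right a b x]

theorem UniformlyPerfect.exists_disjoint_balls [Nontrivial X] (hX : UniformlyPerfect X) :
    ∃ θ r₀ : ℝ, 0 < θ ∧ θ ≤ 1 ∧ 0 < r₀ ∧ ∀ (x : X) (r : ℝ), 0 < r → r ≤ r₀ → ∃ y,
      Metric.ball x (θ * r) ⊆ Metric.ball x r ∧ Metric.ball y (θ * r) ⊆ Metric.ball x r ∧
        Disjoint (Metric.ball x (θ * r)) (Metric.ball y (θ * r)) := by
  obtain ⟨l, hl, hl_one, hperfect⟩ := hX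
  obtain ⟨r₀, hr₀, hcompl⟩ := exists_forall_compl_ball_nonempty (X := X)
  refine ⟨l / 4, r₀, by positivity, by linarith, hr₀, fun x r hr hr_le => ?_⟩
  obtain ⟨y, hy, hy'⟩ := hperfect x (r / 2) (half_pos hr) (hcompl x (r / 2) (by linarith))
  rw [Metric.mem_ball] at hy
  rw [Metric.mem_ball, not_lt] at hy'
  have hlr : l * r < r := mul_lt_of_lt_one_left hr hl_one
  exact ⟨y, Metric.ball_subset_ball (by linarith), Metric.ball_subset_ball' (by linarith),
    Metric.ball_disjoint_ball (by rw [dist_comm]; linarith)⟩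

variable [MeasurableSpace X] {μ : Measure X}

theorem UniformlyPerfect.exists_disjoint_balls_real_le [Nontrivial X] (hX : UniformlyPerfect X) :
    ∃ θ r₀ : ℝ, 0 < θ ∧ θ ≤ 1 ∧ 0 < r₀ ∧ ∀ (x : X) (r : ℝ), 0 < r → r ≤ r₀ → ∃ z z',
      Metric.ball z (θ * r) ⊆ Metric.ball x r ∧ Metric.ball z' (θ * r) ⊆ Metric.ball x r ∧
        Disjoint (Metric.ball z (θ * r)) (Metric.ball z' (θ * r)) ∧
        μ.real (Metric.ball z (θ * r)) ≤ μ.real (Metric.ball z' (θ * r)) := by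
  obtain ⟨θ, r₀, hθ, hθ_one, hr₀, h⟩ := hX.exists_disjoint_balls
  refine ⟨θ, r₀, hθ, hθ_one, hr₀, fun x r hr hr_le => ?_⟩
  obtain ⟨y, hx, hy, hdisj⟩ := h x r hr hr_le
  rcases le_total (μ.real (Metric.ball x (θ * r))) (μ.real (Metric.ball y (θ * r))) with hle | hle
  · exact ⟨x, y, hx, hy, hdisj, hle⟩
  · exact ⟨y, x, hy, hx, hdisj.symm, hle⟩

theorem IsMetricMeasure.exists_ofReal_le_measure_compl_ball [BorelSpace X]
    (hμ : IsMetricMeasure μ) (x₀ : X) : ∃ m : ℝ, 0 < m ∧ m ≤ 1 ∧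
      ∀ z r, μ.real (Metric.ball z r) ≤ m → ENNReal.ofReal m ≤ μ (Metric.ball z r)ᶜ := by
  set V := μ.real (Metric.ball x₀ 1)
  have hV_pos : 0 < V := hμ.real_ball_pos x₀ one_pos
  refine ⟨min 1 (V / 2), by positivity, min_le_left _ _, fun z r hzr => ?_⟩
  calc ENNReal.ofReal (min 1 (V / 2)) ≤ ENNReal.ofReal (V - μ.real (Metric.ball z r)) :=
        ENNReal.ofReal_le_ofReal (by linarith [min_le_right 1 (V / 2)])
    _ = μ (Metric.ball x₀ 1) - μ (Metric.ball z r) := by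
        rw [ENNReal.ofReal_sub _ measureReal_nonneg, hμ.ofReal_real_ball, hμ.ofReal_real_ball]
    _ ≤ μ (Metric.ball x₀ 1 \ Metric.ball z r) := le_measure_sdiff
    _ ≤ μ (Metric.ball z r)ᶜ := measure_mono fun _ hy => hy.2

end Balls

/-! ### Sobolev embeddings -/

section Sobolev

variable {X : Type*} [MetricSpace X] [MeasurableSpace X] {μ : Measure X}
  {s p γ : X → ℝ} {q : X → ℝ≥0∞} {A : HajlaszScale}

theorem mul_mul_div_sub_eq {s p γ : ℝ} (hp : 0 < p) (hγ : 0 < γ) (h : 0 < 1 / p - 1 / γ) :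
    γ * s * p / (γ - p) = s / (1 / p - 1 / γ) := by
  have hsub : γ - p ≠ 0 := fun h₀ => by
    rw [sub_eq_zero.mp h₀, sub_self] at h
    exact lt_irrefl _ h
  field_simp

theorem ExponentGG.sobolev_exponent_eq (hμ : IsMetricMeasure μ) (hp : IsBddLogExponent μ p)
    (hγ : IsBddLogExponent μ γ) (hγp : ExponentGG μ γ p) (s : X → ℝ) (x : X) :
    γ x * s x * p x / (γ x - p x) = s x / (1 / p x - 1 / γ x) := by
  obtain ⟨κ, hκ, hκB⟩ := hγp.exists_forall_le_one_div_sub hμ hp hγ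
  exact mul_mul_div_sub_eq (hp.1.2.1 x) (hγ.1.2.1 x) (hκ.trans_le (hκB x))

theorem ExponentGG.sobolev_exponent_nonneg (hμ : IsMetricMeasure μ) (hp : IsBddLogExponent μ p)
    (hγ : IsBddLogExponent μ γ) (hγp : ExponentGG μ γ p) {x : X} (hs : 0 ≤ s x) :
    0 ≤ s x / (1 / p x - 1 / γ x) := by
  obtain ⟨κ, hκ, hκB⟩ := hγp.exists_forall_le_one_div_sub hμ hp hγ
  exact div_nonneg hs (hκ.le.trans (hκB x))

theorem inv_one_div_add_le {a b d : ℝ} (ha : 0 < a) (hb : 0 < b) (h : |1 / a - 1 / b| ≤ d) :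
    (1 / a + d)⁻¹ ≤ b := by
  have hd : 0 ≤ d := (abs_nonneg _).trans h
  rw [inv_le_comm₀ (by positivity) hb, inv_eq_one_div]
  linarith [(abs_le.mp h).1]

theorem HomEmbedsLebesgue.modConst (h : HomEmbedsLebesgue A μ s p q γ) :
    HomEmbedsLebesgueModConst A μ s p q γ := by
  obtain ⟨C, hC, h⟩ := h
  exact ⟨C, hC, fun u hu => (iInf_le _ 0).trans (by simpa only [sub_zero] using h u hu)⟩

theorem lebesgueNorm_radialBump_le_lebesgueNorm_bumpProfile (hp : ∀ x, 0 ≤ p x)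
    (hs : ∀ x, 0 ≤ s x) {z : X} {a b : ℝ} (hab : a < b) (hba : b - a ≤ 1) :
    lebesgueNorm μ p (fun y => ENNReal.ofReal |radialBump z a b y|) ≤
      lebesgueNorm μ p (bumpProfile s z a b) := by
  refine lebesgueNorm_mono_ae hp (ae_of_all _ fun y => ?_)
  by_cases hy : y ∈ Metric.ball z b
  · rw [bumpProfile, indicator_of_mem hy]
    simp only [abs_of_nonneg (radialBump_nonneg z a b y)]
    exact ENNReal.ofReal_le_ofReal ((radialBump_le_one z a b y).trans
      (Real.one_le_rpow_of_pos_of_le_one_of_nonpos (sub_pos.mpr hab) hba (by linarith [hs y])))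
  · simp [radialBump_eq_zero hab hy]

variable [BorelSpace X]

theorem mul_rpow_real_closedBall_le_of_iInf_le (hμ : IsMetricMeasure μ) (hp : ∀ x, 0 < p x)
    (hγ : ∀ x, 0 < γ x) {ν : Measure X} {F : Set X} {x z : X} {r d a b m G M K : ℝ}
    (hab : a < b) (hba : b - a ≤ 1) (hb : 0 < b) (hd : 0 ≤ d)
    (hzb : Metric.ball z b ⊆ Metric.ball x r) (hsd : ∀ y, dist x y < r → |s x - s y| ≤ d)
    (hpd : ∀ y, dist x y < r → |1 / p x - 1 / p y| ≤ d)
    (hγd : ∀ y, dist x y < r → |1 / γ x - 1 / γ y| ≤ d) (hv : μ.real (Metric.ball z b) ≤ 1)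
    (hν : ENNReal.ofReal (μ.real (Metric.closedBall z a)) ≤ ν (Metric.closedBall z a))
    (hF : MeasurableSet F) (hFb : Disjoint (Metric.ball z b) F) (hm : ENNReal.ofReal m ≤ ν F)
    (hm₀ : 0 ≤ m) (hm_one : m ≤ 1) (hG : 0 < G) (hγF : ∀ y ∈ F, G⁻¹ ≤ γ y)
    (hM_one : M ≤ 1) (hM : M * μ.real (Metric.closedBall z a) ^ (1 / γ x + d) ≤ m ^ G)
    (hK : 0 ≤ K)
    (h : (⨅ c : ℝ, lebesgueNorm ν γ fun y => ENNReal.ofReal |radialBump z a b y - c|) ≤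
      ENNReal.ofReal K * lebesgueNorm μ p (bumpProfile s z a b)) :
    M * μ.real (Metric.closedBall z a) ^ (1 / γ x + d) ≤
      2 * K * ((b - a) ^ (-(s x + d)) * μ.real (Metric.ball z b) ^ (1 / p x - d)) := by
  have hγx := hγ x
  have hab_ball : Metric.closedBall z a ⊆ Metric.ball z b := Metric.closedBall_subset_ball hab
  set g := 1 / γ x + d
  have hg_pos : 0 < g := by positivity
  set w := μ.real (Metric.closedBall z a)
  have hw_one : w ≤ 1 := (hμ.real_mono_of_subset_ball hab_ball).trans hv
  have hγg : ∀ y ∈ Metric.closedBall z a, g⁻¹ ≤ γ y := fun y hy =>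
    inv_one_div_add_le hγx (hγ y) (hγd y (Metric.mem_ball'.mp (hzb (hab_ball hy))))
  have hlower := half_mul_min_rpow_le_iInf_lebesgueNorm_sub (ν := ν) (u := radialBump z a b)
    Metric.isClosed_closedBall.measurableSet hF (fun y hy => radialBump_eq_one hab hy)
    (fun y hy => radialBump_eq_zero hab (disjoint_right.mp hFb hy)) hg_pos hG hγg hγF hν hm
    (ENNReal.ofReal_le_one.mpr hw_one) (ENNReal.ofReal_le_one.mpr hm_one)
  have hupper := h.trans (mul_le_mul_right
    (lebesgueNorm_bumpProfile_le_of_oscillation hμ hp hab hba hb hzb hsd hpd hv) _)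
  have hwm : M * w ^ g ≤ min (w ^ g) (m ^ G) :=
    le_min (mul_le_of_le_one_left (by positivity) hM_one) hM
  have hreal := hlower.trans hupper
  rw [ENNReal.ofReal_rpow_of_nonneg measureReal_nonneg hg_pos.le,
    ENNReal.ofReal_rpow_of_nonneg hm₀ hG.le, ← ENNReal.ofReal_min,
    ← ENNReal.ofReal_mul (by norm_num), ← ENNReal.ofReal_mul hK, ENNReal.ofReal_le_ofReal_iff
      (mul_nonneg hK (mul_nonneg (Real.rpow_nonneg (sub_pos.mpr hab).le _)
        (by positivity)))] at hreal
  linarith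

theorem lowerAhlforsRegular_of_forall_iInf_radialBump_le (hμ : IsMetricMeasure μ)
    (hp : IsBddLogExponent μ p) (hs : IsBddLogExponent μ s) (hγ : IsBddLogExponent μ γ)
    (hγp : ExponentGG μ γ p) {K : ℝ} (hK : 0 < K) (h : ∀ z a b, a < b → b - a ≤ 1 →
      (⨅ c : ℝ, lebesgueNorm μ γ fun y => ENNReal.ofReal |radialBump z a b y - c|) ≤
        ENNReal.ofReal K * lebesgueNorm μ p (bumpProfile s z a b)) :
    LowerAhlforsRegular μ fun x => s x / (1 / p x - 1 / γ x) := by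
  rcases isEmpty_or_nonempty X with _ | ⟨⟨x₀⟩⟩
  · exact ⟨1, one_pos, fun x => isEmptyElim x⟩
  obtain ⟨κ, hκ, hκB⟩ := hγp.exists_forall_le_one_div_sub hμ hp hγ
  obtain ⟨_, S₁, -, -, -, hS₁⟩ := hs.exists_bounds hμ
  obtain ⟨γ₀, _, hγ₀, -, hγ₀γ, -⟩ := hγ.exists_bounds hμ
  obtain ⟨m, hm, hm_one, hcompl⟩ := hμ.exists_ofReal_le_measure_compl_ball x₀
  have hM_one : m ^ γ₀⁻¹ ≤ 1 := Real.rpow_le_one hm.le hm_one (by positivity)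
  refine lowerAhlforsRegular_of_forall_closedBall (f := ![s, fun x => 1 / p x, fun x => 1 / γ x])
    (G := γ₀⁻¹ + κ / 4) (θ := 1) (K := 2 * K / m ^ γ₀⁻¹) (v₀ := m) (r₀ := 1)
    (by intro i; fin_cases i; exacts [hs.logHolder hμ, hp.2, hγ.2]) hμ hs.1.2.1 hS₁ hκ hκB
    one_pos le_rfl (by positivity) hm one_pos fun x r d _ hr_one hd hdκ hosc hv _ => ?_
  have hγx := hγ.1.2.1 x
  have hγ₀x : 1 / γ x ≤ γ₀⁻¹ := by rw [one_div]; exact inv_anti₀ hγ₀ (hγ₀γ x)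
  refine ⟨x, 1 / γ x + d, 0, by rw [one_mul], by positivity, by linarith, by positivity,
    fun t' t htt' ht hw => ?_⟩
  rw [one_mul] at ht
  have ht'_nonneg : 0 ≤ t' := Metric.nonempty_closedBall.mp
    (nonempty_of_measure_ne_zero (ENNReal.toReal_pos_iff.mp hw).1.ne')
  have hvt : μ.real (Metric.ball x t) ≤ m :=
    (hμ.real_mono_of_subset_ball (Metric.ball_subset_ball ht)).trans hv
  have hw_one : μ.real (Metric.closedBall x t') ≤ 1 := (hμ.real_mono_of_subset_ball
    (Metric.closedBall_subset_ball htt')).trans (hvt.trans hm_one)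
  have hest := mul_rpow_real_closedBall_le_of_iInf_le (G := γ₀⁻¹) (M := m ^ γ₀⁻¹) hμ hp.1.2.1
    hγ.1.2.1 htt' (by linarith) (by linarith) hd (Metric.ball_subset_ball ht) (hosc 0) (hosc 1)
    (hosc 2) (hvt.trans hm_one) (hμ.ofReal_real_closedBall x t').le
    Metric.isOpen_ball.measurableSet.compl disjoint_compl_right (hcompl x t hvt) hm.le hm_one
    (by positivity) (fun y _ => by rw [inv_inv]; exact hγ₀γ y) hM_one
    (mul_le_of_le_one_right (by positivity) (Real.rpow_le_one hw.le hw_one (by positivity)))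
    hK.le (h x t' t htt' (by linarith))
  rw [Real.rpow_zero, mul_one, div_mul_eq_mul_div, le_div_iff₀ (by positivity), mul_comm]
  rw [show 1 / p x - 1 / γ x - 2 * d - 0 + (1 / γ x + d) = 1 / p x - d by ring]
  exact hest

theorem HomEmbedsLebesgueModConst.exists_forall_iInf_radialBump_le (hμ : IsMetricMeasure μ)
    (hp : ∀ x, 0 ≤ p x) (hs : IsBddLogExponent μ s) (hq : IsExponent μ q)
    (hsq : SmoothnessAdmissible μ s q) (h : HomEmbedsLebesgueModConst A μ s p q γ) :
    ∃ K : ℝ, 0 < K ∧ ∀ z a b, a < b →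
      (⨅ c : ℝ, lebesgueNorm μ γ fun y => ENNReal.ofReal |radialBump z a b y - c|) ≤
        ENNReal.ofReal K * lebesgueNorm μ p (bumpProfile s z a b) := by
  obtain ⟨C, hC, h⟩ := h
  obtain ⟨K, hK, hbump⟩ := exists_homNorm_radialBump_le A hμ hp hs hq hsq
  refine ⟨C * K, by positivity, fun z a b hab => ?_⟩
  rcases eq_or_ne (lebesgueNorm μ p (bumpProfile s z a b)) ∞ with htop | htop
  · simp [htop, ENNReal.mul_top, hC, hK]
  rw [ENNReal.ofReal_mul hC.le, mul_assoc]
  exact (h _ ⟨(continuous_radialBump z a b).measurable, (hbump z a b hab univ).trans_lt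
    (ENNReal.mul_lt_top ENNReal.ofReal_lt_top htop.lt_top)⟩).trans
    (mul_le_mul_right (hbump z a b hab univ) _)

theorem InhomEmbedsLebesgue.exists_forall_iInf_radialBump_le (hμ : IsMetricMeasure μ)
    (hp : ∀ x, 0 ≤ p x) (hs : IsBddLogExponent μ s) (hq : IsExponent μ q)
    (hsq : SmoothnessAdmissible μ s q) (h : InhomEmbedsLebesgue A μ s p q γ) :
    ∃ K : ℝ, 0 < K ∧ ∀ z a b, a < b → b - a ≤ 1 →
      (⨅ c : ℝ, lebesgueNorm μ γ fun y => ENNReal.ofReal |radialBump z a b y - c|) ≤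
        ENNReal.ofReal K * lebesgueNorm μ p (bumpProfile s z a b) := by
  obtain ⟨C, hC, h⟩ := h
  obtain ⟨K, hK, hbump⟩ := exists_homNorm_radialBump_le A hμ hp hs hq hsq
  refine ⟨C * (1 + K), by positivity, fun z a b hab hba => ?_⟩
  rcases eq_or_ne (lebesgueNorm μ p (bumpProfile s z a b)) ∞ with htop | htop
  · simp [htop, ENNReal.mul_top, mul_pos hC (by positivity : 0 < 1 + K)]
  have hnorm : inhomNorm A μ s p q (radialBump z a b) ≤
      ENNReal.ofReal (1 + K) * lebesgueNorm μ p (bumpProfile s z a b) := by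
    rw [ENNReal.ofReal_add zero_le_one hK.le, ENNReal.ofReal_one, add_mul, one_mul]
    exact add_le_add (lebesgueNorm_radialBump_le_lebesgueNorm_bumpProfile hp
      (fun x => (hs.1.2.1 x).le) hab hba) (hbump z a b hab univ)
  calc (⨅ c : ℝ, lebesgueNorm μ γ fun y => ENNReal.ofReal |radialBump z a b y - c|)
      ≤ lebesgueNorm μ γ fun y => ENNReal.ofReal |radialBump z a b y| :=
        (iInf_le _ 0).trans_eq (by simp only [sub_zero])
    _ ≤ ENNReal.ofReal C * inhomNorm A μ s p q (radialBump z a b) :=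
        h _ (continuous_radialBump z a b).measurable
          (hnorm.trans_lt (ENNReal.mul_lt_top ENNReal.ofReal_lt_top htop.lt_top))
    _ ≤ ENNReal.ofReal (C * (1 + K)) * lebesgueNorm μ p (bumpProfile s z a b) := by
        rw [ENNReal.ofReal_mul hC.le, mul_assoc]
        gcongr

theorem lowerAhlforsRegular_of_embedsLebesgue (hμ : IsMetricMeasure μ)
    (hp : IsBddLogExponent μ p) (hs : IsBddLogExponent μ s) (hq : IsExponent μ q)
    (hsq : SmoothnessAdmissible μ s q) (hγ : IsBddLogExponent μ γ) (hγp : ExponentGG μ γ p)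
    (h : HomEmbedsLebesgue A μ s p q γ ∨ HomEmbedsLebesgueModConst A μ s p q γ ∨
      InhomEmbedsLebesgue A μ s p q γ) :
    LowerAhlforsRegular μ fun x => s x / (1 / p x - 1 / γ x) := by
  have hp_nonneg : ∀ x, 0 ≤ p x := fun x => (hp.1.2.1 x).le
  have hmodConst (h : HomEmbedsLebesgueModConst A μ s p q γ) :
      LowerAhlforsRegular μ fun x => s x / (1 / p x - 1 / γ x) := by
    obtain ⟨K, hK, hbump⟩ := h.exists_forall_iInf_radialBump_le hμ hp_nonneg hs hq hsq
    exact lowerAhlforsRegular_of_forall_iInf_radialBump_le hμ hp hs hγ hγp hK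
      fun z a b hab _ => hbump z a b hab
  rcases h with h | h | h
  · exact hmodConst h.modConst
  · exact hmodConst h
  · obtain ⟨K, hK, hbump⟩ := h.exists_forall_iInf_radialBump_le hμ hp_nonneg hs hq hsq
    exact lowerAhlforsRegular_of_forall_iInf_radialBump_le hμ hp hs hγ hγp hK hbump

end Sobolev

section LocalSobolev

variable {X : Type*} [MetricSpace X] [MeasurableSpace X]

/-- The local Sobolev inequality of exponent `γ` on balls of radius at most `1 / σ`, in which the
local dimension `Q` enters through a power of the density ratio `μ (B(x₀, r₀)) / r₀ ^ Q(x₀)`. -/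
def LocalSobolevInequality (A : HajlaszScale) (μ : Measure X) (σ : ℝ) (s p : X → ℝ)
    (q : X → ℝ≥0∞) (γ Q : X → ℝ) : Prop :=
  ∃ C ω : ℝ, 0 < C ∧ 0 < ω ∧ ∀ (x₀ : X) (r₀ : ℝ), 0 < r₀ → r₀ ≤ 1 / σ →
    ∀ u : X → ℝ, MemHom A μ s p q (Metric.ball x₀ (σ * r₀)) u →
      (⨅ c : ℝ, lebesgueNorm (μ.restrict (Metric.ball x₀ r₀)) γ
          (fun x => ENNReal.ofReal |u x - c|)) ≤
        ENNReal.ofReal C * (μ (Metric.ball x₀ r₀) / ENNReal.ofReal (r₀ ^ Q x₀)) ^ ω *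
          homNorm A μ s p q (Metric.ball x₀ (σ * r₀)) u

variable [BorelSpace X] {μ : Measure X} {σ : ℝ} {s p γ Q : X → ℝ} {q : X → ℝ≥0∞}
  {A : HajlaszScale}

theorem LocalSobolevInequality.exists_forall_iInf_radialBump_le (hμ : IsMetricMeasure μ)
    (hp : ∀ x, 0 ≤ p x) (hs : IsBddLogExponent μ s) (hq : IsExponent μ q)
    (hsq : SmoothnessAdmissible μ s q) (h : LocalSobolevInequality A μ σ s p q γ Q) :
    ∃ K : ℝ, 0 < K ∧ ∀ x r, 0 < r → r ≤ 1 / σ → μ.real (Metric.ball x r) ≤ r ^ Q x →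
      ∀ z a b, a < b → (⨅ c : ℝ, lebesgueNorm (μ.restrict (Metric.ball x r)) γ
        fun y => ENNReal.ofReal |radialBump z a b y - c|) ≤
        ENNReal.ofReal K * lebesgueNorm μ p (bumpProfile s z a b) := by
  obtain ⟨C, ω, hC, hω, h⟩ := h
  obtain ⟨K, hK, hbump⟩ := exists_homNorm_radialBump_le A hμ hp hs hq hsq
  refine ⟨C * K, by positivity, fun x r hr hrσ hv z a b hab => ?_⟩
  rcases eq_or_ne (lebesgueNorm μ p (bumpProfile s z a b)) ∞ with htop | htop
  · simp [htop, ENNReal.mul_top, hC, hK]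
  have hbump := hbump z a b hab (Metric.ball x (σ * r))
  have hratio : (μ (Metric.ball x r) / ENNReal.ofReal (r ^ Q x)) ^ ω ≤ 1 := by
    refine ENNReal.rpow_le_one (ENNReal.div_le_of_le_mul ?_) hω.le
    rw [one_mul, ← hμ.ofReal_real_ball]
    exact ENNReal.ofReal_le_ofReal hv
  calc _ ≤ ENNReal.ofReal C * (μ (Metric.ball x r) / ENNReal.ofReal (r ^ Q x)) ^ ω *
          homNorm A μ s p q (Metric.ball x (σ * r)) (radialBump z a b) :=
        h x r hr hrσ _ ⟨(continuous_radialBump z a b).measurable,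
          hbump.trans_lt (ENNReal.mul_lt_top ENNReal.ofReal_lt_top htop.lt_top)⟩
    _ ≤ ENNReal.ofReal C * 1 * (ENNReal.ofReal K * lebesgueNorm μ p (bumpProfile s z a b)) := by
        gcongr
    _ = ENNReal.ofReal (C * K) * lebesgueNorm μ p (bumpProfile s z a b) := by
        rw [mul_one, ENNReal.ofReal_mul hC.le, mul_assoc]

theorem rpow_real_closedBall_le_of_iInf_restrict_le (hμ : IsMetricMeasure μ) (hp : ∀ x, 0 < p x)
    (hγ : ∀ x, 0 < γ x) {x z z' : X} {r ρ d a b K : ℝ} (hab : a < b) (hba : b - a ≤ 1)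
    (hb : 0 < b) (hzb : Metric.ball z b ⊆ Metric.ball x r)
    (hz' : Metric.ball z' ρ ⊆ Metric.ball x r)
    (hdisj : Disjoint (Metric.ball z b) (Metric.ball z' ρ))
    (hzz' : μ.real (Metric.closedBall z a) ≤ μ.real (Metric.ball z' ρ))
    (hsd : ∀ y, dist x y < r → |s x - s y| ≤ d)
    (hpd : ∀ y, dist x y < r → |1 / p x - 1 / p y| ≤ d)
    (hγd : ∀ y, dist x y < r → |1 / γ x - 1 / γ y| ≤ d) (hv : μ.real (Metric.ball x r) ≤ 1)
    (hK : 0 ≤ K) (h : (⨅ c : ℝ, lebesgueNorm (μ.restrict (Metric.ball x r)) γ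
      fun y => ENNReal.ofReal |radialBump z a b y - c|) ≤
        ENNReal.ofReal K * lebesgueNorm μ p (bumpProfile s z a b)) :
    μ.real (Metric.closedBall z a) ^ (1 / γ x + d) ≤
      2 * K * ((b - a) ^ (-(s x + d)) * μ.real (Metric.ball z b) ^ (1 / p x - d)) := by
  have hd : 0 ≤ d :=
    (abs_nonneg _).trans (hsd z (Metric.mem_ball'.mp (hzb (Metric.mem_ball_self hb))))
  have hγx := hγ x
  have hz'a : Metric.closedBall z a ⊆ Metric.ball x r :=
    (Metric.closedBall_subset_ball hab).trans hzb
  simpa only [one_mul] using mul_rpow_real_closedBall_le_of_iInf_le (G := 1 / γ x + d) (M := 1)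
    hμ hp hγ hab hba hb hd hzb hsd hpd hγd ((hμ.real_mono_of_subset_ball hzb).trans hv)
    (by rw [Measure.restrict_eq_self _ hz'a, hμ.ofReal_real_closedBall])
    Metric.isOpen_ball.measurableSet hdisj
    (by rw [Measure.restrict_eq_self _ hz', hμ.ofReal_real_ball]) measureReal_nonneg
    ((hμ.real_mono_of_subset_ball hz').trans hv) (by positivity)
    (fun y hy => inv_one_div_add_le hγx (hγ y) (hγd y (Metric.mem_ball'.mp (hz' hy)))) le_rfl
    (by rw [one_mul]; exact Real.rpow_le_rpow measureReal_nonneg hzz' (by positivity)) hK h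

theorem lowerAhlforsRegular_of_localSobolevInequality [Nontrivial X] (hμ : IsMetricMeasure μ)
    (hX : UniformlyPerfect X) (hσ : 0 < σ) (hp : IsBddLogExponent μ p)
    (hs : IsBddLogExponent μ s) (hq : IsExponent μ q) (hsq : SmoothnessAdmissible μ s q)
    (hγ : IsBddLogExponent μ γ) (hγp : ExponentGG μ γ p)
    (h : LocalSobolevInequality A μ σ s p q γ fun x => s x / (1 / p x - 1 / γ x)) :
    LowerAhlforsRegular μ fun x => s x / (1 / p x - 1 / γ x) := by
  obtain ⟨θ, r₀, hθ, hθ_one, hr₀, hballs⟩ := hX.exists_disjoint_balls_real_le (μ := μ)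
  obtain ⟨κ, hκ, hκB⟩ := hγp.exists_forall_le_one_div_sub hμ hp hγ
  obtain ⟨_, S₁, -, -, -, hS₁⟩ := hs.exists_bounds hμ
  obtain ⟨γ₀, _, hγ₀, -, hγ₀γ, -⟩ := hγ.exists_bounds hμ
  obtain ⟨K, hK, hbump⟩ :=
    h.exists_forall_iInf_radialBump_le hμ (fun x => (hp.1.2.1 x).le) hs hq hsq
  refine lowerAhlforsRegular_of_forall_closedBall (f := ![s, fun x => 1 / p x, fun x => 1 / γ x])
    (G := γ₀⁻¹ + κ / 4) (θ := θ) (K := 2 * K) (v₀ := 1) (r₀ := min r₀ (min (1 / σ) 1))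
    (by intro i; fin_cases i; exacts [hs.logHolder hμ, hp.2, hγ.2]) hμ hs.1.2.1 hS₁ hκ hκB
    hθ hθ_one (by positivity) one_pos (by positivity) fun x r d hr hr_le hd hdκ hosc hv hvr => ?_
  obtain ⟨hrr₀, hrσ, hr_one⟩ : r ≤ r₀ ∧ r ≤ 1 / σ ∧ r ≤ 1 := by simpa only [le_min_iff] using hr_le
  obtain ⟨z, z', hz, hz', hdisj, hzz'⟩ := hballs x r hr hrr₀
  have hγx := hγ.1.2.1 x
  have hγ₀x : 1 / γ x ≤ γ₀⁻¹ := by rw [one_div]; exact inv_anti₀ hγ₀ (hγ₀γ x)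
  refine ⟨z, 1 / γ x + d, 0, hz, by positivity, by linarith, by positivity,
    fun t' t htt' ht hw => ?_⟩
  have ht'_nonneg : 0 ≤ t' := Metric.nonempty_closedBall.mp
    (nonempty_of_measure_ne_zero (ENNReal.toReal_pos_iff.mp hw).1.ne')
  have htz : Metric.ball z t ⊆ Metric.ball z (θ * r) := Metric.ball_subset_ball ht
  have ht'z : Metric.closedBall z t' ⊆ Metric.ball z (θ * r) :=
    (Metric.closedBall_subset_ball htt').trans htz
  have hest := rpow_real_closedBall_le_of_iInf_restrict_le hμ hp.1.2.1 hγ.1.2.1 htt'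
    (by nlinarith) (ht'_nonneg.trans_lt htt') (htz.trans hz) hz' (hdisj.mono_left htz)
    ((hμ.real_mono_of_subset_ball ht'z).trans hzz') (hosc 0) (hosc 1) (hosc 2) hv hK.le
    (hbump x r hr hrσ hvr z t' t htt')
  rw [Real.rpow_zero, mul_one,
    show 1 / p x - 1 / γ x - 2 * d - 0 + (1 / γ x + d) = 1 / p x - d by ring]
  exact hest

end LocalSobolev

/-! ### Moser–Trudinger inequalities -/

section MoserTrudinger

theorem le_mul_rpow_of_exp_rpow_le {x y g ω : ℝ} (hx : 0 ≤ x) (hg : 0 < g) (hω : 0 < ω)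
    (h : Real.exp (x ^ ω) ≤ y) : x ≤ (ω * g)⁻¹ ^ ω⁻¹ * y ^ g := by
  have hy : 0 < y := (Real.exp_pos _).trans_le h
  have hlog : x ^ ω ≤ (ω * g)⁻¹ * y ^ (ω * g) := by
    rw [inv_mul_eq_div]
    exact ((Real.le_log_iff_exp_le hy).mpr h).trans (Real.log_le_rpow_div hy.le (by positivity))
  calc x = (x ^ ω) ^ ω⁻¹ := (Real.rpow_rpow_inv hx hω.ne').symm
    _ ≤ ((ω * g)⁻¹ * y ^ (ω * g)) ^ ω⁻¹ := by gcongr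
    _ = (ω * g)⁻¹ ^ ω⁻¹ * y ^ g := by
      rw [Real.mul_rpow (by positivity) (by positivity), ← Real.rpow_mul hy.le,
        mul_right_comm, mul_inv_cancel₀ hω.ne', one_mul]

theorem rpow_le_of_div_mul_exp_le {C₁ C₂ N v w g ω : ℝ} (hC₁ : 0 < C₁) (hN : 0 < N) (hv : 0 < v)
    (hw : 0 < w) (hg : 0 < g) (hω : 0 < ω)
    (h : w / v * Real.exp ((C₁ * (1 / 2 / N)) ^ ω) ≤ C₂) :
    w ^ g ≤ 2 / C₁ * (ω * g)⁻¹ ^ ω⁻¹ * C₂ ^ g * v ^ g * N := by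
  have hC₂ : 0 < C₂ := lt_of_lt_of_le (by positivity) h
  have hexp : Real.exp ((C₁ * (1 / 2 / N)) ^ ω) ≤ C₂ * v / w := by
    rw [le_div_iff₀ hw]
    rw [div_mul_eq_mul_div, div_le_iff₀ hv] at h
    linarith
  have hmain := le_mul_rpow_of_exp_rpow_le (by positivity) hg hω hexp
  rw [Real.div_rpow (by positivity) hw.le, Real.mul_rpow hC₂.le hv.le] at hmain
  calc w ^ g = C₁ * (1 / 2 / N) * w ^ g * (2 / C₁ * N) := by field_simp
    _ ≤ (ω * g)⁻¹ ^ ω⁻¹ * (C₂ ^ g * v ^ g / w ^ g) * w ^ g * (2 / C₁ * N) := by gcongr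
    _ = 2 / C₁ * (ω * g)⁻¹ ^ ω⁻¹ * C₂ ^ g * v ^ g * N := by field_simp

variable {X : Type*} [MetricSpace X] [MeasurableSpace X]

/-- The local Moser–Trudinger inequality on balls of radius at most `1 / σ`: uniform exponential
integrability of normalized functions, up to additive constants. -/
def LocalMoserTrudingerInequality (A : HajlaszScale) (μ : Measure X) (σ : ℝ) (s p : X → ℝ)
    (q : X → ℝ≥0∞) : Prop :=
  ∃ C₁ C₂ ω : ℝ, 0 < C₁ ∧ 0 < C₂ ∧ 0 < ω ∧ ∀ (x₀ : X) (r₀ : ℝ), 0 < r₀ → r₀ ≤ 1 / σ →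
    ∀ u : X → ℝ, MemHom A μ s p q (Metric.ball x₀ (σ * r₀)) u →
      0 < homNorm A μ s p q (Metric.ball x₀ (σ * r₀)) u →
      (⨅ c : ℝ, expAverage μ (Metric.ball x₀ r₀) ω (fun x => C₁ * (|u x - c| /
          (homNorm A μ s p q (Metric.ball x₀ (σ * r₀)) u).toReal))) ≤ ENNReal.ofReal C₂

variable {μ : Measure X} {σ : ℝ} {s p : X → ℝ} {q : X → ℝ≥0∞} {A : HajlaszScale}

theorem homNorm_radialBump_pos (hμ : IsMetricMeasure μ) (hp : IsBddLogExponent μ p)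
    (hq : IsExponent μ q) {E F : Set X} (hE : MeasurableSet E) {z : X} {a b : ℝ} (hab : a < b)
    (haE : Metric.closedBall z a ⊆ E) (hFE : F ⊆ E) (hFb : Disjoint (Metric.ball z b) F)
    (ha : 0 < μ.real (Metric.closedBall z a)) (hF : 0 < μ.real F) :
    0 < homNorm A μ s p q E (radialBump z a b) := by
  obtain ⟨p₀, _, hp₀, -, hp₀p, -⟩ := hp.exists_bounds hμ
  obtain ⟨q₀, hq₀, hq₀q⟩ := hq.exists_ofReal_le
  refine homNorm_pos_of_forall_ne hp.1.1 hp₀ hp₀p hq₀ hq₀q hE haE hFE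
    (ENNReal.toReal_pos_iff.mp ha).1 (ENNReal.toReal_pos_iff.mp hF).1 fun y hy y' hy' => ?_
  rw [radialBump_eq_one hab hy, radialBump_eq_zero hab (disjoint_right.mp hFb hy')]
  exact one_ne_zero

variable [BorelSpace X]

theorem rpow_real_closedBall_le_of_iInf_expAverage_le (hμ : IsMetricMeasure μ) {B F : Set X}
    {z : X} {a b v C₁ C₂ N g ω : ℝ} (hab : a < b) (haB : Metric.closedBall z a ⊆ B)
    (hF : MeasurableSet F) (hFB : F ⊆ B) (hFb : Disjoint (Metric.ball z b) F)
    (ha : 0 < μ.real (Metric.closedBall z a))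
    (haF : ENNReal.ofReal (μ.real (Metric.closedBall z a)) ≤ μ F) (hv : 0 < v)
    (hB : μ B = ENNReal.ofReal v) (hC₁ : 0 < C₁) (hC₂ : 0 ≤ C₂) (hN : 0 < N) (hg : 0 < g)
    (hω : 0 < ω)
    (h : (⨅ c : ℝ, expAverage μ B ω fun y => C₁ * (|radialBump z a b y - c| / N)) ≤
      ENNReal.ofReal C₂) :
    μ.real (Metric.closedBall z a) ^ g ≤
      2 / C₁ * (ω * g)⁻¹ ^ ω⁻¹ * C₂ ^ g * v ^ g * N := by
  refine rpow_le_of_div_mul_exp_le hC₁ hN hv ha hg hω ?_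
  rw [← ENNReal.ofReal_le_ofReal_iff hC₂]
  exact (ofReal_div_mul_exp_le_iInf_expAverage_sub Metric.isClosed_closedBall.measurableSet
    hF haB hFB (fun y hy => radialBump_eq_one hab hy)
    (fun y hy => radialBump_eq_zero hab (disjoint_right.mp hFb hy)) hC₁.le hN.le hω.le
    (hμ.ofReal_real_closedBall z a).le haF hv hB).trans h

theorem LocalMoserTrudingerInequality.exists_forall_rpow_real_closedBall_le
    (hμ : IsMetricMeasure μ) (hσ : 1 ≤ σ) (hp : IsBddLogExponent μ p)
    (hs : IsBddLogExponent μ s) (hq : IsExponent μ q) (hsq : SmoothnessAdmissible μ s q)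
    (h : LocalMoserTrudingerInequality A μ σ s p q) {g : ℝ} (hg : 0 < g) :
    ∃ K : ℝ, 0 < K ∧ ∀ x r, 0 < r → r ≤ 1 / σ → ∀ z z' a b ρ T, a < b → 0 ≤ T →
      Metric.ball z b ⊆ Metric.ball x r → Metric.ball z' ρ ⊆ Metric.ball x r →
      Disjoint (Metric.ball z b) (Metric.ball z' ρ) → 0 < μ.real (Metric.closedBall z a) →
      μ.real (Metric.closedBall z a) ≤ μ.real (Metric.ball z' ρ) →
      lebesgueNorm μ p (bumpProfile s z a b) ≤ ENNReal.ofReal T →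
      μ.real (Metric.closedBall z a) ^ g ≤ K * μ.real (Metric.ball x r) ^ g * T := by
  obtain ⟨C₁, C₂, ω, hC₁, hC₂, hω, h⟩ := h
  obtain ⟨K, hK, hbump⟩ :=
    exists_homNorm_radialBump_le A hμ (fun x => (hp.1.2.1 x).le) hs hq hsq
  refine ⟨2 / C₁ * (ω * g)⁻¹ ^ ω⁻¹ * C₂ ^ g * K, by positivity,
    fun x r hr hrσ z z' a b ρ T hab hT hzb hz' hdisj hw hzz' hprofile => ?_⟩
  have hσr : Metric.ball x r ⊆ Metric.ball x (σ * r) :=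
    Metric.ball_subset_ball (le_mul_of_one_le_left hr.le hσ)
  have hza : Metric.closedBall z a ⊆ Metric.ball x r :=
    (Metric.closedBall_subset_ball hab).trans hzb
  have hnorm_le : homNorm A μ s p q (Metric.ball x (σ * r)) (radialBump z a b) ≤
      ENNReal.ofReal (K * T) := by
    rw [ENNReal.ofReal_mul hK.le]
    exact (hbump z a b hab _).trans (by gcongr)
  have hnorm_top := hnorm_le.trans_lt ENNReal.ofReal_lt_top
  have hnorm_pos := homNorm_radialBump_pos (A := A) (s := s) hμ hp hq
    Metric.isOpen_ball.measurableSet hab (hza.trans hσr) (hz'.trans hσr) hdisj hw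
    (hw.trans_le hzz')
  refine (rpow_real_closedBall_le_of_iInf_expAverage_le hμ hab hza
    Metric.isOpen_ball.measurableSet hz' hdisj hw
    ((ENNReal.ofReal_le_ofReal hzz').trans_eq (hμ.ofReal_real_ball z' ρ)) (hμ.real_ball_pos x hr)
    (hμ.ofReal_real_ball x r).symm hC₁ hC₂.le (ENNReal.toReal_pos hnorm_pos.ne' hnorm_top.ne) hg hω
    (h x r hr hrσ _ ⟨(continuous_radialBump z a b).measurable, hnorm_top⟩ hnorm_pos)).trans ?_
  rw [show ∀ c v : ℝ, c * K * v * T = c * v * (K * T) from fun _ _ => by ring]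
  gcongr
  exact ENNReal.toReal_le_of_le_ofReal (by positivity) hnorm_le

theorem lowerAhlforsRegular_of_localMoserTrudingerInequality [Nontrivial X]
    (hμ : IsMetricMeasure μ) (hX : UniformlyPerfect X) (hσ : 1 ≤ σ) (hp : IsBddLogExponent μ p)
    (hs : IsBddLogExponent μ s) (hq : IsExponent μ q) (hsq : SmoothnessAdmissible μ s q)
    (h : LocalMoserTrudingerInequality A μ σ s p q) :
    LowerAhlforsRegular μ fun x => s x * p x := by
  obtain ⟨θ, r₀, hθ, hθ_one, hr₀, hballs⟩ := hX.exists_disjoint_balls_real_le (μ := μ)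
  obtain ⟨_, S₁, -, -, -, hS₁⟩ := hs.exists_bounds hμ
  obtain ⟨_, p₁, -, hp₁, -, hpp₁⟩ := hp.exists_bounds hμ
  set κ := 1 / p₁
  have hκ : 0 < κ := by positivity
  obtain ⟨K, hK, hest⟩ :=
    h.exists_forall_rpow_real_closedBall_le hμ hσ hp hs hq hsq (g := κ / 4) (by positivity)
  rw [show (fun x => s x * p x) = fun x => s x / (1 / p x) by
    simp only [one_div, div_inv_eq_mul]]
  refine lowerAhlforsRegular_of_forall_closedBall (f := ![s, fun x => 1 / p x]) (G := κ / 4)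
    (κ := κ) (θ := θ) (K := K) (v₀ := 1) (r₀ := min r₀ (min (1 / σ) 1))
    (by intro i; fin_cases i; exacts [hs.logHolder hμ, hp.2]) hμ hs.1.2.1 hS₁ hκ
    (fun x => one_div_le_one_div_of_le (hp.1.2.1 x) (hpp₁ x)) hθ hθ_one hK one_pos
    (by positivity) fun x r d hr hr_le hd _ hosc hv _ => ?_
  obtain ⟨hrr₀, hrσ, hr_one⟩ : r ≤ r₀ ∧ r ≤ 1 / σ ∧ r ≤ 1 := by simpa only [le_min_iff] using hr_le
  obtain ⟨z, z', hz, hz', hdisj, hzz'⟩ := hballs x r hr hrr₀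
  refine ⟨z, κ / 4, κ / 4, hz, by positivity, le_rfl, le_rfl, fun t' t htt' ht hw => ?_⟩
  have htz : Metric.ball z t ⊆ Metric.ball z (θ * r) := Metric.ball_subset_ball ht
  have ht'z : Metric.closedBall z t' ⊆ Metric.ball z t := Metric.closedBall_subset_ball htt'
  have ht'_nonneg : 0 ≤ t' := Metric.nonempty_closedBall.mp
    (nonempty_of_measure_ne_zero (ENNReal.toReal_pos_iff.mp hw).1.ne')
  have ht_pos : 0 < t := ht'_nonneg.trans_lt htt'
  have hvt : μ.real (Metric.ball z t) ≤ 1 :=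
    (hμ.real_mono_of_subset_ball (htz.trans hz)).trans hv
  have htt'_nonneg : 0 ≤ t - t' := (sub_pos.mpr htt').le
  have hpow : μ.real (Metric.ball z t) ^ (1 / p x - d) ≤
      μ.real (Metric.ball z t) ^ (1 / p x - 2 * d - κ / 4 + κ / 4) :=
    Real.rpow_le_rpow_of_exponent_ge (hμ.real_ball_pos z ht_pos) hvt (by linarith)
  exact hest x r hr hrσ z z' t' t (θ * r) _ htt' (by positivity) (htz.trans hz) hz'
    (hdisj.mono_left htz) hw ((hμ.real_mono_of_subset_ball (ht'z.trans htz)).trans hzz')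
    ((lebesgueNorm_bumpProfile_le_of_oscillation hμ hp.1.2.1 htt' (by nlinarith) ht_pos
      (htz.trans hz) (hosc 0) (hosc 1) hvt).trans
        (ENNReal.ofReal_le_ofReal (mul_le_mul_of_nonneg_left hpow (by positivity))))

end MoserTrudinger

/-! ### Hölder embeddings -/

section Holder

theorem nonpos_of_forall_le_mul_rpow {c D t R : ℝ} (hc : 0 < c) (hR : 0 < R)
    (h : ∀ r, 0 < r → r ≤ R → c ≤ D * r ^ t) : t ≤ 0 := by
  by_contra! ht
  have hlim : Filter.Tendsto (fun r : ℝ => D * r ^ t) (nhdsWithin 0 (Ioi 0)) (nhds 0) := by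
    have h0 := (Real.continuousAt_rpow_const 0 t (Or.inr ht.le)).tendsto.const_mul D
    rw [Real.zero_rpow ht.ne', mul_zero] at h0
    exact h0.mono_left nhdsWithin_le_nhds
  refine hc.not_ge (ge_of_tendsto hlim ?_)
  filter_upwards [Ioc_mem_nhdsGT hR] with r hr using h r hr.1 hr.2

theorem ofReal_div_rpow_le_holderSeminorm {X : Type*} [MetricSpace X] (α v : X → ℝ) {x y : X}
    (hxy : x ≠ y) : ENNReal.ofReal (|v x - v y| / dist x y ^ α x) ≤ holderSeminorm α v :=
  le_iSup_of_le x (le_iSup_of_le y (le_iSup_of_le hxy le_rfl))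

variable {X : Type*} [MetricSpace X] [MeasurableSpace X] [BorelSpace X] {μ : Measure X}
  {p s α : X → ℝ} {q : X → ℝ≥0∞} {A : HajlaszScale}

theorem LowerAhlforsRegular.measure_singleton_pos (hμ : IsMetricMeasure μ) {Q : X → ℝ}
    (h : LowerAhlforsRegular μ Q) {x : X} (hx : Q x = 0) : 0 < μ {x} := by
  obtain ⟨b, hb, h⟩ := h
  rw [← Metric.closedBall_zero]
  refine (ENNReal.ofReal_pos.mpr hb).trans_le
    (le_measure_closedBall_of_forall_gt hμ x fun r hr => ?_)
  have hmin := h x (min r 1) (lt_min hr one_pos) (min_le_right _ _)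
  rw [hx, Real.rpow_zero, mul_one] at hmin
  exact hmin.trans (measure_mono (Metric.ball_subset_ball (min_le_left _ _)))

theorem HomEmbedsHolder.exists_forall_rpow_le [Nontrivial X] (hμ : IsMetricMeasure μ)
    (hX : UniformlyPerfect X) (hp : ∀ x, 0 ≤ p x) (hs : IsBddLogExponent μ s)
    (hq : IsExponent μ q) (hsq : SmoothnessAdmissible μ s q) (hα : ∀ x, 0 ≤ α x)
    (h : HomEmbedsHolder A μ s p q α) :
    ∃ l K R : ℝ, 0 < l ∧ l < 1 ∧ 0 < K ∧ 0 < R ∧ ∀ x r, 0 < r → r ≤ R → ∀ T, 0 ≤ T →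
      lebesgueNorm μ p (bumpProfile s x 0 r) ≤ ENNReal.ofReal T → (l / r) ^ α x ≤ K * T := by
  have := hμ.isOpenPosMeasure
  obtain ⟨l, hl, hl_one, hperf⟩ := hX
  obtain ⟨K, hK, hbump⟩ := exists_homNorm_radialBump_le A hμ hp hs hq hsq
  obtain ⟨R, hR, hcompl⟩ := exists_forall_compl_ball_nonempty (X := X)
  obtain ⟨C, hC, h⟩ := h
  refine ⟨l, C * K, l * R, hl, hl_one, by positivity, by positivity, fun x r hr hrR T hT hxT => ?_⟩
  obtain ⟨y, hy_lt, hy_ge⟩ := hperf x (r / l) (by positivity)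
    (hcompl x _ (by rwa [div_le_iff₀' hl]))
  rw [mul_div_cancel₀ _ hl.ne'] at hy_ge
  have hxy : x ≠ y := ne_of_mem_of_not_mem (Metric.mem_ball_self hr) hy_ge
  have hdist : 0 < dist x y := dist_pos.mpr hxy
  have hnorm : homNorm A μ s p q univ (radialBump x 0 r) ≤ ENNReal.ofReal (K * T) := by
    rw [ENNReal.ofReal_mul hK.le]
    exact (hbump x 0 r hr univ).trans (mul_le_mul_right hxT _)
  obtain ⟨v, hv_cont, hv_ae, hv⟩ := h _
    ⟨(continuous_radialBump x 0 r).measurable, hnorm.trans_lt ENNReal.ofReal_lt_top⟩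
  obtain rfl : v = radialBump x 0 r :=
    (hv_cont.ae_eq_iff_eq μ (continuous_radialBump x 0 r)).mp hv_ae
  have hquot : ENNReal.ofReal (|radialBump x 0 r x - radialBump x 0 r y| / dist x y ^ α x) ≤
      ENNReal.ofReal (C * (K * T)) := by
    rw [ENNReal.ofReal_mul hC.le]
    exact (ofReal_div_rpow_le_holderSeminorm α _ hxy).trans
      (hv.trans (mul_le_mul_right hnorm _))
  rw [ENNReal.ofReal_le_ofReal_iff (by positivity),
    radialBump_eq_one hr (Metric.mem_closedBall_self le_rfl), radialBump_eq_zero hr hy_ge,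
    sub_zero, abs_one] at hquot
  calc (l / r) ^ α x ≤ (1 / dist x y) ^ α x := by
        refine Real.rpow_le_rpow (by positivity) ?_ (hα x)
        rw [Metric.mem_ball', lt_div_iff₀' hl] at hy_lt
        rw [div_le_div_iff₀ hr hdist, one_mul]
        exact hy_lt.le
    _ = 1 / dist x y ^ α x := by rw [Real.div_rpow zero_le_one hdist.le, Real.one_rpow]
    _ ≤ C * K * T := by rwa [mul_assoc]

theorem exists_lebesgueNorm_bumpProfile_le_mul_rpow (hμ : IsMetricMeasure μ)
    (hp : IsBddLogExponent μ p) (hs : LogHolder s) (x : X) :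
    ∃ D r₁, 0 ≤ D ∧ 0 < r₁ ∧ ∀ r, 0 < r → r ≤ r₁ →
      lebesgueNorm μ p (bumpProfile s x 0 r) ≤ ENNReal.ofReal (D * r ^ (-s x)) := by
  obtain ⟨p₀, _, hp₀, -, hp₀p, -⟩ := hp.exists_bounds hμ
  obtain ⟨C, r₁, hr₁, hr₁_one, hosc⟩ :=
    exists_forall_oscillation_le (f := fun _ : Unit => s) (fun _ => hs) one_pos
  set m := max 1 (μ.real (Metric.ball x 1))
  have hm : 1 ≤ m := le_max_left _ _
  refine ⟨Real.exp C * m ^ p₀⁻¹, r₁, by positivity, hr₁, fun r hr hrr₁ => ?_⟩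
  obtain ⟨d, -, -, hdC, hd⟩ := hosc r hr hrr₁
  have hr_one : r ≤ 1 := hrr₁.trans hr₁_one.le
  have hμr : ∀ y ∈ Metric.ball x r,
      μ (Metric.ball x r) ≤ ENNReal.ofReal ((m ^ p₀⁻¹) ^ p y) := fun y _ => by
    rw [← Real.rpow_mul (by positivity), ← hμ.ofReal_real_ball]
    refine ENNReal.ofReal_le_ofReal ?_
    calc μ.real (Metric.ball x r) ≤ μ.real (Metric.ball x 1) :=
          hμ.real_mono_of_subset_ball (Metric.ball_subset_ball hr_one)
      _ ≤ m := le_max_right _ _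
      _ ≤ m ^ (p₀⁻¹ * p y) := Real.self_le_rpow_of_one_le hm
          ((one_le_inv_mul₀ hp₀).mpr (hp₀p y))
  have hs_le : ∀ y ∈ Metric.ball x r, s y ≤ s x + d := fun y hy => by
    have := (abs_le.mp (hd () x y (Metric.mem_ball'.mp hy))).1
    linarith
  refine (lebesgueNorm_bumpProfile_le hp.1.2.1 hr (by rwa [sub_zero]) hs_le (by positivity)
    hμr).trans (ENNReal.ofReal_le_ofReal ?_)
  have hexp : r ^ (-d) ≤ Real.exp C := by
    rw [Real.rpow_def_of_pos hr, Real.exp_le_exp]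
    rw [one_div, Real.log_inv] at hdC
    linarith
  calc (r - 0) ^ (-(s x + d)) * m ^ p₀⁻¹ = r ^ (-d) * m ^ p₀⁻¹ * r ^ (-s x) := by
        rw [sub_zero, neg_add, Real.rpow_add hr]
        ring
    _ ≤ Real.exp C * m ^ p₀⁻¹ * r ^ (-s x) := by gcongr

theorem HomEmbedsHolder.exponent_le [Nontrivial X] (hμ : IsMetricMeasure μ)
    (hX : UniformlyPerfect X) (hp : IsBddLogExponent μ p) (hs : IsBddLogExponent μ s)
    (hq : IsExponent μ q) (hsq : SmoothnessAdmissible μ s q) (hα : ∀ x, 0 ≤ α x)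
    (h : HomEmbedsHolder A μ s p q α) (x : X) : α x ≤ s x := by
  obtain ⟨l, K, R, hl, -, hK, hR, h⟩ :=
    h.exists_forall_rpow_le hμ hX (fun x => (hp.1.2.1 x).le) hs hq hsq hα
  obtain ⟨D, r₁, hD, hr₁, hprofile⟩ :=
    exists_lebesgueNorm_bumpProfile_le_mul_rpow hμ hp (hs.logHolder hμ) x
  refine sub_nonpos.mp (nonpos_of_forall_le_mul_rpow (c := l ^ α x) (D := K * D)
    (by positivity) (lt_min hR hr₁) fun r hr hrR => ?_)
  have hle := h x r hr (hrR.trans (min_le_left _ _)) _ (by positivity)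
    (hprofile r hr (hrR.trans (min_le_right _ _)))
  rw [Real.div_rpow hl.le hr.le, div_le_iff₀ (by positivity)] at hle
  calc l ^ α x ≤ K * (D * r ^ (-s x)) * r ^ α x := hle
    _ = K * D * r ^ (α x - s x) := by
      rw [sub_eq_add_neg, Real.rpow_add hr]
      ring

theorem HomEmbedsHolder.lowerAhlforsRegular [Nontrivial X] (hμ : IsMetricMeasure μ)
    (hX : UniformlyPerfect X) (hp : IsBddLogExponent μ p) (hs : IsBddLogExponent μ s)
    (hq : IsExponent μ q) (hsq : SmoothnessAdmissible μ s q) (hα : ∀ x, 0 ≤ α x)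
    (h : HomEmbedsHolder A μ s p q α) :
    LowerAhlforsRegular μ fun x => p x * (s x - α x) := by
  have hαs := h.exponent_le hμ hX hp hs hq hsq hα
  obtain ⟨l, K, R, hl, hl_one, hK, hR, h⟩ :=
    h.exists_forall_rpow_le hμ hX (fun x => (hp.1.2.1 x).le) hs hq hsq hα
  obtain ⟨_, s₁, -, -, -, hs₁⟩ := hs.exists_bounds hμ
  obtain ⟨_, p₁, -, hp₁, -, hpp₁⟩ := hp.exists_bounds hμ
  simp_rw [fun x => show p x * (s x - α x) = (s x - α x) / (1 / p x) by field_simp]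
  refine lowerAhlforsRegular_of_forall_oscillation (f := ![s, fun x => 1 / p x])
    (S₁ := s₁) (κ := 1 / p₁) (D := K / l ^ s₁) (v₀ := 1) (r₀ := min R 1)
    (by intro i; fin_cases i; exacts [hs.logHolder hμ, hp.2]) hμ
    (fun x => sub_nonneg.mpr (hαs x)) (fun x => by linarith [hs₁ x, hα x]) (by positivity)
    (fun x => one_div_le_one_div_of_le (hp.1.2.1 x) (hpp₁ x)) one_pos (by positivity)
    fun x r d hr hrR hd _ hosc hv _ => ?_
  have hv_pos := hμ.real_ball_pos x hr
  have hprofile := lebesgueNorm_bumpProfile_le_of_oscillation hμ hp.1.2.1 hr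
    (by rw [sub_zero]; exact hrR.trans (min_le_right _ _)) hr Subset.rfl (hosc 0) (hosc 1) hv
  rw [sub_zero] at hprofile
  have hle := h x r hr (hrR.trans (min_le_left _ _)) _ (by positivity) hprofile
  set v := μ.real (Metric.ball x r)
  rw [Real.div_rpow hl.le hr.le, div_le_iff₀ (by positivity)] at hle
  have hl_le : l ^ s₁ ≤ l ^ α x :=
    Real.rpow_le_rpow_of_exponent_ge hl hl_one.le ((hαs x).trans (hs₁ x))
  have hv_le : v ^ (1 / p x - d) ≤ v ^ (1 / p x - 2 * d) :=
    Real.rpow_le_rpow_of_exponent_ge hv_pos hv (by linarith)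
  rw [div_mul_eq_mul_div, le_div_iff₀ (by positivity)]
  calc r ^ (s x - α x + d) * l ^ s₁ ≤ r ^ (s x - α x + d) * l ^ α x := by gcongr
    _ ≤ r ^ (s x - α x + d) * (K * (r ^ (-(s x + d)) * v ^ (1 / p x - d)) * r ^ α x) :=
      mul_le_mul_of_nonneg_left hle (by positivity)
    _ = K * v ^ (1 / p x - d) := by
      rw [show s x - α x + d = -(-(s x + d)) - α x by ring, Real.rpow_sub hr, Real.rpow_neg hr.le]
      field_simp
    _ ≤ K * v ^ (1 / p x - 2 * d) := by gcongr

end Holder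

theorem mainTheorem3_general {X : Type*} [MetricSpace X] [MeasurableSpace X] [BorelSpace X]
    (μ : Measure X) (hμ : IsMetricMeasure μ) (A : HajlaszScale) (σ : ℝ) (hσ : 1 ≤ σ)
    (p s : X → ℝ) (q : X → ℝ≥0∞) (hp : IsBddLogExponent μ p) (hs : IsBddLogExponent μ s)
    (hq : IsExponent μ q) (hsq : SmoothnessAdmissible μ s q) :
    (∀ γ : X → ℝ, IsBddLogExponent μ γ → ExponentGG μ γ p →
      (HomEmbedsLebesgue A μ s p q γ ∨ HomEmbedsLebesgueModConst A μ s p q γ ∨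
        InhomEmbedsLebesgue A μ s p q γ) →
      LowerAhlforsRegular μ (fun x => γ x * s x * p x / (γ x - p x))) ∧
    (UniformlyPerfect X →
      (∀ γ : X → ℝ, IsBddLogExponent μ γ → ExponentGG μ γ p →
        ∀ Q : X → ℝ, (∀ x, Q x = s x * p x * γ x / (γ x - p x)) →
        LocalSobolevInequality A μ σ s p q γ Q → LowerAhlforsRegular μ Q) ∧
      (LocalMoserTrudingerInequality A μ σ s p q →
        LowerAhlforsRegular μ (fun x => s x * p x)) ∧
      (Nontrivial X → ∀ α : X → ℝ, (∀ x, 0 ≤ α x) → HomEmbedsHolder A μ s p q α →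
        (∀ x, α x ≤ s x) ∧
        LowerAhlforsRegular μ (fun x => p x * (s x - α x)) ∧
        ∀ x₀ : X, s x₀ = α x₀ → 0 < μ {x₀})) := by
  refine ⟨fun γ hγ hγp h => ?_, fun hX => ⟨fun γ hγ hγp Q hQ h => ?_, fun h => ?_,
    fun _ α hα h => ?_⟩⟩
  · simp_rw [hγp.sobolev_exponent_eq hμ hp hγ s]
    exact lowerAhlforsRegular_of_embedsLebesgue hμ hp hs hq hsq hγ hγp h
  · obtain rfl : Q = fun x => s x / (1 / p x - 1 / γ x) := funext fun x => by
      rw [hQ, ← hγp.sobolev_exponent_eq hμ hp hγ]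
      ring
    rcases subsingleton_or_nontrivial X with _ | _
    · exact lowerAhlforsRegular_of_subsingleton hμ fun x =>
        hγp.sobolev_exponent_nonneg hμ hp hγ (hs.1.2.1 x).le
    · exact lowerAhlforsRegular_of_localSobolevInequality hμ hX (by linarith) hp hs hq hsq hγ hγp h
  · rcases subsingleton_or_nontrivial X with _ | _
    · exact lowerAhlforsRegular_of_subsingleton hμ fun x =>
        mul_nonneg (hs.1.2.1 x).le (hp.1.2.1 x).le
    · exact lowerAhlforsRegular_of_localMoserTrudingerInequality hμ hX hσ hp hs hq hsq h
  · have hreg := h.lowerAhlforsRegular hμ hX hp hs hq hsq hα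
    exact ⟨h.exponent_le hμ hX hp hs hq hsq hα, hreg,
      fun x₀ hx₀ => hreg.measure_singleton_pos hμ (by rw [hx₀, sub_self, mul_zero])⟩

theorem mainTheorem3 {X : Type*} [MetricSpace X] [MeasurableSpace X] [BorelSpace X]
    (μ : Measure X) (hμ : IsMetricMeasure μ) (A : HajlaszScale) (σ : ℝ) (hσ : 1 ≤ σ)
    (p s : X → ℝ) (q : X → ℝ≥0∞) (hp : IsBddLogExponent μ p) (hs : IsBddLogExponent μ s)
    (hq : IsExponent μ q) (hsq : SmoothnessAdmissible μ s q) :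
    -- (i) global Sobolev embedding
    (∀ γ : X → ℝ, IsBddLogExponent μ γ → ExponentGG μ γ p →
      (HomEmbedsLebesgue A μ s p q γ ∨ HomEmbedsLebesgueModConst A μ s p q γ ∨
        InhomEmbedsLebesgue A μ s p q γ) →
      LowerAhlforsRegular μ (fun x => γ x * s x * p x / (γ x - p x))) ∧
    (UniformlyPerfect X →
      -- (ii) local Sobolev inequalities
      (∀ γ : X → ℝ, IsBddLogExponent μ γ → ExponentGG μ γ p →
        ∀ Q : X → ℝ, (∀ x, Q x = s x * p x * γ x / (γ x - p x)) →
        (∃ C ω : ℝ, 0 < C ∧ 0 < ω ∧ ∀ (x₀ : X) (r₀ : ℝ), 0 < r₀ → r₀ ≤ 1 / σ →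
          ∀ u : X → ℝ, MemHom A μ s p q (Metric.ball x₀ (σ * r₀)) u →
            (⨅ c : ℝ, lebesgueNorm (μ.restrict (Metric.ball x₀ r₀)) γ
                (fun x => ENNReal.ofReal |u x - c|)) ≤
              ENNReal.ofReal C *
                (μ (Metric.ball x₀ r₀) / ENNReal.ofReal (r₀ ^ Q x₀)) ^ ω *
                homNorm A μ s p q (Metric.ball x₀ (σ * r₀)) u) →
        LowerAhlforsRegular μ Q) ∧
      -- (iii) local Moser-Trudinger inequalities
      ((∃ C₁ C₂ ω : ℝ, 0 < C₁ ∧ 0 < C₂ ∧ 0 < ω ∧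
          ∀ (x₀ : X) (r₀ : ℝ), 0 < r₀ → r₀ ≤ 1 / σ →
          ∀ u : X → ℝ, MemHom A μ s p q (Metric.ball x₀ (σ * r₀)) u →
            0 < homNorm A μ s p q (Metric.ball x₀ (σ * r₀)) u →
            (⨅ c : ℝ, expAverage μ (Metric.ball x₀ r₀) ω (fun x => C₁ * (|u x - c| /
                (homNorm A μ s p q (Metric.ball x₀ (σ * r₀)) u).toReal))) ≤
              ENNReal.ofReal C₂) →
        LowerAhlforsRegular μ (fun x => s x * p x)) ∧
      -- (iv) global Hölder embedding
      (Nontrivial X → ∀ α : X → ℝ, IsBddLogExponent μ α → HomEmbedsHolder A μ s p q α →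
        (∀ x, α x ≤ s x) ∧
        LowerAhlforsRegular μ (fun x => p x * (s x - α x)) ∧
        ∀ x₀ : X, s x₀ = α x₀ → 0 < μ {x₀})) := by
  obtain ⟨hglobal, hlocal⟩ := mainTheorem3_general μ hμ A σ hσ p s q hp hs hq hsq
  exact ⟨hglobal, fun hX => ⟨(hlocal hX).1, (hlocal hX).2.1,
    fun hnt α hα => (hlocal hX).2.2 hnt α fun x => (hα.1.2.1 x).le⟩⟩
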